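/- Let $n\ge 1$ be an integer. Let $\Gamma_1=\langle \mu,y\mid \mu W=Wy\rangle$, $W=y^{-1}\mu y\mu^{-1}$, be the group of the figure-eight knot, with meridian $\mu$ and longitude $\lambda=WW^*$, $W^*=\mu^{-1}y\mu y^{-1}$. Let $\Gamma_2^n=\langle a,m\mid a(am)^n=(am)^na\rangle$ be the group of the $(2,2n)$-torus link, where $a,m$ are meridians of the two components, and let $\mathcal L=(am)^na^{-n}$ and $l=(am)^nm^{-n}$, the peripheral elements that commute with $a$, respectively $m$, and are homologous to $m^n$, respectively $a^n$. Let $N_n$ be the 3-manifold obtained by gluing the boundary of the figure-eight knot exterior to the boundary component of the torus link exterior that carries $\{l,m\}$ so that $l=\mu^4\lambda$ and $m=\mu^3\lambda$. Thus $\pi_1(N_n)$ is the amalgamated free product $$\Gamma_n=\Gamma_1*_{\,l=\mu^4\lambda,\ m=\mu^3\lambda}\Gamma_2^n ,$$ and $\{\mathcal L,a\}$ generates $\pi_1(\partial N_n)\cong\mathbb Z^2$. Write $X(\Gamma)$ for the algebraic set of characters of representations $\Gamma\to\mathrm{SL}_2(\mathbb C)$, and let $i^*:X(\Gamma_n)\to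 X(\pi_1(\partial N_n))$ be the restriction map. Let $D$ be the union of the sets $i^*(X_j)$ over all irreducible components $X_j$ of $X(\Gamma_n)$ that contain the character of an irreducible representation and satisfy $\dim_{\mathbb C} i^*(X_j)=1$ (the dimension of the Zariski closure). Let $\overline D\subset\mathbb C^\times\times\mathbb C^\times$ be the set of all $(X,Y)$ such that the character of the representation $\mathcal L\mapsto\mathrm{diag}(X,X^{-1})$, $a\mapsto \mathrm{diag}(Y,Y^{-1})$ of $\pi_1(\partial N_n)$ lies in $D$. The A-polynomial $A_{N_n}(X,Y)=\sum a_{ij}X^iY^j\in\mathbb Z[X,Y]$ of $N_n$ with respect to $\{\mathcal L,a\}$ is the polynomial with relatively prime integer coefficients, unique up to sign, that generates the ideal of all polynomials in $\mathbb C[X,Y]$ vanishing on $\overline D$. Its Newton polygon is the convex hull in $\mathbb R^2$ of $\{(i,j): a_{ij}\ne0\}$. For an edge $e$ of the Newton polygon, of slope $p/q$ with $p,q$ coprime integers ($q=0$ for a vertical edge) whose signs are chosen so that $e$ is the set of points of the polygon at which $px-qy$ is minimal, choose integers $a',b'$ with $pb'-a'q=1$. The edge polynomial of $e$ is $$f_e(t)=t^{-k}\sum_{(i,j)\in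 e}a_{ij}\,t^{\,b'j-a'i},$$ where $k\in\mathbb Z$ is such that $f_e\in\mathbb Z[t]$ and $f_e(0)\neq0$. Then the A-polynomial $A_{N_n}$ exists, and its Newton polygon has a vertical edge $e$ such that $1-t^n$ divides $f_e(t)$ in $\mathbb Z[t]$. -/

import Mathlib

noncomputable section

namespace APolynomialRoots

/-! ### Character varieties of `SL(2, ℂ)`-representations -/

/-- The group `SL₂(ℂ)`. -/
abbrev SL2C : Type := Matrix.SpecialLinearGroup (Fin 2) ℂ

/-- The character `γ ↦ Tr (ρ γ)` of a representation `ρ : Γ → SL₂(ℂ)`. -/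
def character {Γ : Type*} [Group Γ] (ρ : Γ →* SL2C) : Γ → ℂ :=
  fun γ => Matrix.trace (ρ γ : Matrix (Fin 2) (Fin 2) ℂ)

/-- `ρ` is irreducible: the only `ρ(Γ)`-invariant subspaces of `ℂ²` are `0` and `ℂ²`. -/
def IsIrreducibleRep {Γ : Type*} [Group Γ] (ρ : Γ →* SL2C) : Prop :=
  ∀ W : Submodule ℂ (Fin 2 → ℂ),
    (∀ γ : Γ, ∀ v ∈ W, (ρ γ : Matrix (Fin 2) (Fin 2) ℂ).mulVec v ∈ W) → W = ⊥ ∨ W = ⊤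

/-- `X(Γ)`, the set of characters of representations `Γ → SL₂(ℂ)`. -/
def CharacterVariety (Γ : Type*) [Group Γ] : Type _ :=
  {χ : Γ → ℂ // ∃ ρ : Γ →* SL2C, character ρ = χ}

/-- The Zariski topology on `X(Γ)`: the closed sets are the common zero sets of polynomials in the
functions `I_γ(χ) = χ(γ)`, `γ ∈ Γ`. For finitely generated `Γ` all the `I_γ` are polynomials in
finitely many of them, say `m`, and this is the topology of `X(Γ)` as an algebraic set
in `ℂ^m`. -/
instance CharacterVariety.instTopologicalSpace (Γ : Type*) [Group Γ] :
    TopologicalSpace (CharacterVariety Γ) :=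
  TopologicalSpace.generateFrom
    {U | ∃ p : MvPolynomial Γ ℂ, U = {χ : CharacterVariety Γ | MvPolynomial.eval χ.1 p ≠ 0}}

/-- The map `X(Γ) → X(Δ)` induced by a homomorphism `φ : Δ → Γ`. -/
def CharacterVariety.restrict {Δ Γ : Type*} [Group Δ] [Group Γ] (φ : Δ →* Γ)
    (χ : CharacterVariety Γ) : CharacterVariety Δ :=
  ⟨fun δ => χ.1 (φ δ), by
    obtain ⟨χ, ρ, rfl⟩ := χ
    exact ⟨ρ.comp φ, rfl⟩⟩

/-! ### The A-polynomial

The data of a 3-manifold `N` with torus boundary that enter its A-polynomial are `Γ = π₁(N)`,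
the peripheral group `π₁(∂N) ≅ ℤ²` with a basis `{λ, μ}`, and the homomorphism
`φ : π₁(∂N) → π₁(N)` induced by inclusion. -/

/-- `ℤ × ℤ`, written multiplicatively: the fundamental group of a torus. The first generator
is `λ` and the second is `μ`. -/
abbrev TorusGroup : Type := Multiplicative ℤ × Multiplicative ℤ

/-- The homomorphism from the torus group to `Γ` that sends the first generator to `x` and the
second to `y`, for commuting `x` and `y`. -/
def torusHom {Γ : Type*} [Group Γ] (x y : Γ) (h : Commute x y) : TorusGroup →* Γ :=
  (zpowersHom Γ x).noncommCoprod (zpowersHom Γ y) (fun i j => by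
    simpa [zpowersHom_apply] using
      h.zpow_zpow (Multiplicative.toAdd i) (Multiplicative.toAdd j))

/-- The diagonal matrix with diagonal entries `z` and `z⁻¹`. -/
def diagSL (z : ℂˣ) : SL2C :=
  ⟨!![(z : ℂ), 0; 0, ((z⁻¹ : ℂˣ) : ℂ)], by simp [Matrix.det_fin_two]⟩

theorem diagSL_commute (z w : ℂˣ) : Commute (diagSL z) (diagSL w) := by
  apply Subtype.ext
  change !![(z : ℂ), 0; 0, ((z⁻¹ : ℂˣ) : ℂ)] * !![(w : ℂ), 0; 0, ((w⁻¹ : ℂˣ) : ℂ)] =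
    !![(w : ℂ), 0; 0, ((w⁻¹ : ℂˣ) : ℂ)] * !![(z : ℂ), 0; 0, ((z⁻¹ : ℂˣ) : ℂ)]
  simp [mul_comm]

/-- The quotient map `ℂˣ × ℂˣ → X(∂N)`: it takes `(L, M)` to the character of the representation
with `λ ↦ diag(L, L⁻¹)` and `μ ↦ diag(M, M⁻¹)`. -/
def torusQuotient (L M : ℂˣ) : CharacterVariety TorusGroup :=
  ⟨character (torusHom (diagSL L) (diagSL M) (diagSL_commute L M)), _, rfl⟩

/-- The components `X_j` of `X(N)` that contain the character of an irreducible representation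
and have `dim i^*(X_j) = 1`. (The dimension of a constructible set is that of its
Zariski closure.) -/
def curveComponents {Γ : Type*} [Group Γ] (φ : TorusGroup →* Γ) :
    Set (Set (CharacterVariety Γ)) :=
  {X | X ∈ irreducibleComponents (CharacterVariety Γ) ∧
    (∃ ρ : Γ →* SL2C, IsIrreducibleRep ρ ∧ ∃ χ ∈ X, χ.1 = character ρ) ∧
    topologicalKrullDim (closure (CharacterVariety.restrict φ '' X)) = 1}

/-- `D_N`, the union of the images `i^*(X_j)`. -/
def imageCurve {Γ : Type*} [Group Γ] (φ : TorusGroup →* Γ) : Set (CharacterVariety TorusGroup) :=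
  ⋃ X ∈ curveComponents φ, CharacterVariety.restrict φ '' X

/-- The inverse image of `D_N` in `ℂˣ × ℂˣ`, as a subset of `ℂ²`; coordinate `0` is `L` and
coordinate `1` is `M`. -/
def eigenvalueCurve {Γ : Type*} [Group Γ] (φ : TorusGroup →* Γ) : Set (Fin 2 → ℂ) :=
  {v | ∃ L M : ℂˣ, v = ![(L : ℂ), (M : ℂ)] ∧ torusQuotient L M ∈ imageCurve φ}

/-- `A ∈ ℤ[L, M]` is the A-polynomial: it is a defining polynomial of the eigenvalue curve (it
generates the ideal of all polynomials that vanish there), and its coefficients are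
relatively prime. This determines `A` up to sign. -/
def IsAPolynomial {Γ : Type*} [Group Γ] (φ : TorusGroup →* Γ) (A : MvPolynomial (Fin 2) ℤ) :
    Prop :=
  Ideal.span {MvPolynomial.map (Int.castRingHom ℂ) A} =
      MvPolynomial.vanishingIdeal ℂ (eigenvalueCurve φ) ∧
    ∀ d : ℤ, (∀ s, d ∣ A.coeff s) → IsUnit d

/-! ### Newton polygons and edge polynomials -/

/-- The point `(i, j) ∈ ℝ²` that belongs to the monomial `L ^ i * M ^ j`. -/
def exponentPoint (s : Fin 2 →₀ ℕ) : ℝ × ℝ := ((s 0 : ℝ), (s 1 : ℝ))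

/-- The Newton polygon of `A`. -/
def newtonPolygon (A : MvPolynomial (Fin 2) ℤ) : Set (ℝ × ℝ) :=
  convexHull ℝ (exponentPoint '' (A.support : Set (Fin 2 →₀ ℕ)))

/-- An edge of a polygon: a face of dimension one. -/
def IsEdge (P e : Set (ℝ × ℝ)) : Prop :=
  IsExposed ℝ P e ∧ Module.finrank ℝ (vectorSpan ℝ e) = 1

/-- `e` lies on a vertical line. -/
def IsVertical (e : Set (ℝ × ℝ)) : Prop := ∃ c : ℝ, ∀ x ∈ e, x.1 = c

open Classical in
/-- `f` is the edge polynomial of the edge `e` of the Newton polygon of `A`. Let `p / q` be the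
slope of `e` and `p * b - a * q = 1`. The substitution `L = Z ^ (-a) * Y ^ p`,
`M = Z ^ b * Y ^ (-q)` turns `L ^ i * M ^ j` into `Z ^ (b * j - a * i) * Y ^ (p * i - q * j)`.
The signs of `p` and `q` are chosen such that `e` carries the terms of `A` with the least
exponent of `Y`; these terms make up a Laurent polynomial in `Z`, and `f` is its product
with the power of `Z` for which `f` is a polynomial and `f(0) ≠ 0`. -/
def IsEdgePolynomial (A : MvPolynomial (Fin 2) ℤ) (e : Set (ℝ × ℝ)) (f : Polynomial ℤ) : Prop :=
  ∃ p q a b : ℤ, p * b - a * q = 1 ∧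
    (∃ c : ℝ, (∀ x ∈ newtonPolygon A, c ≤ p * x.1 - q * x.2) ∧
      e = {x ∈ newtonPolygon A | p * x.1 - q * x.2 = c}) ∧
    f.coeff 0 ≠ 0 ∧
    ∃ m : ℤ, LaurentPolynomial.T m * Polynomial.toLaurent f =
      ∑ s ∈ A.support.filter (fun s => exponentPoint s ∈ e),
        LaurentPolynomial.C (A.coeff s) * LaurentPolynomial.T (b * (s 1 : ℤ) - a * (s 0 : ℤ))

/-! ### The fundamental group of the manifold -/

/-- Generators of the figure-eight knot group. -/
inductive FigEightGen
  | mu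
  | y

/-- The word `W = y⁻¹ μ y μ⁻¹`. -/
def figEightWord {G : Type*} [Group G] (mu y : G) : G := y⁻¹ * mu * y * mu⁻¹

/-- The word `W^* = μ⁻¹ y μ y⁻¹`. -/
def figEightWordStar {G : Type*} [Group G] (mu y : G) : G := mu⁻¹ * y * mu * y⁻¹

/-- `Γ₁ = ⟨μ, y | μ W = W y⟩`, the fundamental group of the exterior of the figure-eight knot. -/
abbrev FigEightGroup : Type :=
  PresentedGroup
    ({FreeGroup.of FigEightGen.mu *
        figEightWord (FreeGroup.of FigEightGen.mu) (FreeGroup.of FigEightGen.y) *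
      (figEightWord (FreeGroup.of FigEightGen.mu) (FreeGroup.of FigEightGen.y) *
        FreeGroup.of FigEightGen.y)⁻¹} : Set (FreeGroup FigEightGen))

/-- The meridian `μ` of the figure-eight knot. -/
def meridian : FigEightGroup := PresentedGroup.of FigEightGen.mu

/-- The longitude `λ = W W^*` of the figure-eight knot. -/
def longitude : FigEightGroup :=
  figEightWord meridian (PresentedGroup.of FigEightGen.y) *
    figEightWordStar meridian (PresentedGroup.of FigEightGen.y)

/-- Generators of the group of the `(2, 2n)`-torus link: a meridian of each component. -/
inductive TorusLinkGen
  | a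
  | m

/-- `Γ₂ = ⟨a, m | a (a m)^n = (a m)^n a⟩`, the fundamental group of the exterior of
the `(2, 2n)`-torus link. -/
abbrev TorusLinkGroup (n : ℕ) : Type :=
  PresentedGroup
    ({FreeGroup.of TorusLinkGen.a * (FreeGroup.of TorusLinkGen.a * FreeGroup.of TorusLinkGen.m) ^ n *
      ((FreeGroup.of TorusLinkGen.a * FreeGroup.of TorusLinkGen.m) ^ n *
        FreeGroup.of TorusLinkGen.a)⁻¹} : Set (FreeGroup TorusLinkGen))

/-- The meridian `a` of the first component. -/
def linkA (n : ℕ) : TorusLinkGroup n := PresentedGroup.of TorusLinkGen.a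

/-- The meridian `m` of the second component. -/
def linkM (n : ℕ) : TorusLinkGroup n := PresentedGroup.of TorusLinkGen.m

/-- The longitude `𝓛` of the first component. It is the element of the peripheral subgroup that
contains `a` (the centralizer of `a`) which is homologous to `m^n`. -/
def linkScriptL (n : ℕ) : TorusLinkGroup n := (linkA n * linkM n) ^ n * (linkA n ^ n)⁻¹

/-- The longitude `l` of the second component. It is the element of the peripheral subgroup that
contains `m` (the centralizer of `m`) which is homologous to `a^n`. -/
def linkL (n : ℕ) : TorusLinkGroup n := (linkA n * linkM n) ^ n * (linkM n ^ n)⁻¹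

theorem linkA_commute_pow (n : ℕ) : Commute ((linkA n * linkM n) ^ n) (linkA n) := by
  have h : linkA n * (linkA n * linkM n) ^ n * ((linkA n * linkM n) ^ n * linkA n)⁻¹ = 1 :=
    PresentedGroup.one_of_mem (rels := {FreeGroup.of TorusLinkGen.a *
      (FreeGroup.of TorusLinkGen.a * FreeGroup.of TorusLinkGen.m) ^ n *
      ((FreeGroup.of TorusLinkGen.a * FreeGroup.of TorusLinkGen.m) ^ n *
        FreeGroup.of TorusLinkGen.a)⁻¹}) rfl
  exact (mul_inv_eq_one.mp h).symm

theorem linkScriptL_commute (n : ℕ) : Commute (linkScriptL n) (linkA n) :=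
  (linkA_commute_pow n).mul_left ((Commute.refl (linkA n)).pow_left n).inv_left

/-- The relators of the gluing that identifies `l` with `μ⁴ λ` and `m` with `μ³ λ`. -/
def gluingRelators (n : ℕ) : Set (Monoid.Coprod FigEightGroup (TorusLinkGroup n)) :=
  {Monoid.Coprod.inl (meridian ^ 4 * longitude) * (Monoid.Coprod.inr (linkL n))⁻¹,
    Monoid.Coprod.inl (meridian ^ 3 * longitude) * (Monoid.Coprod.inr (linkM n))⁻¹}

/-- `Γ_n = π₁(N_n)`, the free product of `Γ₁` and `Γ₂` with the peripheral subgroups `⟨λ, μ⟩` and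
`⟨l, m⟩` amalgamated by `l = μ⁴ λ`, `m = μ³ λ`. -/
abbrev GluedGroup (n : ℕ) : Type :=
  Monoid.Coprod FigEightGroup (TorusLinkGroup n) ⧸ Subgroup.normalClosure (gluingRelators n)

/-- The inclusion of `Γ₂` into `Γ_n`. -/
def linkToGlued (n : ℕ) : TorusLinkGroup n →* GluedGroup n :=
  (QuotientGroup.mk' (Subgroup.normalClosure (gluingRelators n))).comp Monoid.Coprod.inr

/-- The homomorphism `π₁(∂N_n) → π₁(N_n)` induced by inclusion, with respect to the generating set
`{𝓛, a}` of `π₁(∂N_n)`. -/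
def gluedPeripheral (n : ℕ) : TorusGroup →* GluedGroup n :=
  torusHom (linkToGlued n (linkScriptL n)) (linkToGlued n (linkA n))
    ((linkScriptL_commute n).map (linkToGlued n))

end APolynomialRoots

end

noncomputable section

namespace APolynomialRoots

/-! ### Eigenvectors of elements of `SL₂(ℂ)` -/

/-! The vertical edge comes from an ideal point of the figure-eight knot. As the eigenvalue `u⁻¹` of
`μ` tends to infinity along one branch of the irreducible characters, the eigenvalue `ℓ` of `μ⁴λ`
tends to `1`. Such a representation extends to `Γ_n` with diagonal, hence commuting, images of `a`
and `m`: then `l = a ^ n` and `𝓛 = m ^ n`, so it suffices that `a` has an eigenvalue `Y` with `Y ^ n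
= ℓ`, and `𝓛` gets the eigenvalue `X = (u * ℓ) ^ n`. For each choice of the `n`-th root, `(X, Y)`
tends to `(0, ω)` with `ω ^ n = 1`, and every `n`-th root of unity `ω` occurs. So `1 - Y ^ n`
divides `A(0, Y)`, whose monomials are those on the left edge (`branch_mem_eigenvalueCurve`,
`eval_zero_root_eq_zero`).

For this the branch must count towards `D`. All boundary characters of `Γ_n` lie on a proper closed
subset of `X(∂N_n)` (`exists_symmetric_boundary_curve`): `(am)^n` is central in the link group, so
either its image is `±1`, which gives `X ^ 2 * Y ^ (2 * n) = 1`, or `a` and `m` commute and the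
trace of the figure-eight longitude gives an equation in `Y` and an `n`-th root of `X`. Hence any
component of `X(Γ_n)` that contains an irreducible character and is not constant on the boundary has
a one-dimensional image (`image_subset_imageCurve`), and no component has to be computed.

The A-polynomial exists for general reasons. The eigenvalue curve lies on a plane curve and has no
isolated points, so its vanishing ideal is principal (`exists_span_eq_vanishingIdeal`). It is stable
under `Aut(ℂ)`, whose fixed field is `ℚ`, so the generator can be scaled to a primitive integer
polynomial (`exists_primitive_int_generator`).

The left edge is nondegenerate: `A` is not divisible by its first variable because `X ≠ 0` on the
curve, and a single monomial cannot vanish at `Y = 1`. -/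

/-- `v` is an eigenvector of `A` for the eigenvalue `c`. -/
def IsEigen (v : Fin 2 → ℂ) (A : SL2C) (c : ℂˣ) : Prop :=
  (A : Matrix (Fin 2) (Fin 2) ℂ).mulVec v = (c : ℂ) • v

namespace IsEigen

variable {v : Fin 2 → ℂ} {A B : SL2C} {c d : ℂˣ}

theorem one (v : Fin 2 → ℂ) : IsEigen v 1 1 := by simp [IsEigen]

theorem mul (hA : IsEigen v A c) (hB : IsEigen v B d) : IsEigen v (A * B) (c * d) := by
  unfold IsEigen at *
  rw [Matrix.SpecialLinearGroup.coe_mul, ← Matrix.mulVec_mulVec, hB, Matrix.mulVec_smul, hA,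
    smul_smul, Units.val_mul, mul_comm]

theorem inv (hA : IsEigen v A c) : IsEigen v A⁻¹ c⁻¹ := by
  unfold IsEigen at *
  have h : ((A⁻¹ * A : SL2C) : Matrix (Fin 2) (Fin 2) ℂ).mulVec v = v := by simp
  rw [Matrix.SpecialLinearGroup.coe_mul, ← Matrix.mulVec_mulVec, hA, Matrix.mulVec_smul] at h
  conv_rhs => rw [← h]
  rw [smul_smul]
  simp

theorem pow (hA : IsEigen v A c) (k : ℕ) : IsEigen v (A ^ k) (c ^ k) := by
  induction k with
  | zero => simpa using one v
  | succ k ih => simpa [pow_succ] using ih.mul hA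

theorem zpow (hA : IsEigen v A c) (k : ℤ) : IsEigen v (A ^ k) (c ^ k) := by
  cases k with
  | ofNat k => simpa using hA.pow k
  | negSucc k => simpa [zpow_negSucc] using (hA.pow (k + 1)).inv

end IsEigen

theorem charpoly_eq_zero_of_mulVec {A : SL2C} {v : Fin 2 → ℂ} {c : ℂ} (hv : v ≠ 0)
    (h : (A : Matrix (Fin 2) (Fin 2) ℂ).mulVec v = c • v) :
    c ^ 2 - Matrix.trace (A : Matrix (Fin 2) (Fin 2) ℂ) * c + 1 = 0 := by
  have hd := A.2
  rw [Matrix.det_fin_two] at hd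
  have h0 := congrFun h 0
  have h1 := congrFun h 1
  simp only [Matrix.mulVec, dotProduct, Fin.sum_univ_two, Pi.smul_apply, smul_eq_mul] at h0 h1
  rw [Matrix.trace_fin_two]
  by_cases hv0 : v 0 = 0
  · have hv1 : v 1 ≠ 0 := fun hv1 => hv (by ext i; fin_cases i <;> simpa)
    apply mul_right_cancel₀ hv1
    linear_combination -A.1 1 0 * h0 - (c - A.1 0 0) * h1 - (v 1) * hd
  · apply mul_right_cancel₀ hv0
    linear_combination -A.1 0 1 * h1 - (c - A.1 1 1) * h0 - (v 0) * hd

theorem ne_zero_of_mulVec {A : SL2C} {v : Fin 2 → ℂ} {c : ℂ} (hv : v ≠ 0)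
    (h : (A : Matrix (Fin 2) (Fin 2) ℂ).mulVec v = c • v) : c ≠ 0 := by
  rintro rfl
  simpa using charpoly_eq_zero_of_mulVec hv h

theorem IsEigen.trace_eq {A : SL2C} {v : Fin 2 → ℂ} {c : ℂˣ} (hv : v ≠ 0) (h : IsEigen v A c) :
    Matrix.trace (A : Matrix (Fin 2) (Fin 2) ℂ) = c + ((c⁻¹ : ℂˣ) : ℂ) := by
  have := charpoly_eq_zero_of_mulVec hv h
  have hc : (c : ℂ) ≠ 0 := c.ne_zero
  rw [Units.val_inv_eq_inv_val]
  field_simp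
  linear_combination -this

/-- Commuting elements of `SL₂(ℂ)` have a common eigenvector. -/
theorem exists_common_eigenvector {A B : SL2C} (h : Commute A B) :
    ∃ v : Fin 2 → ℂ, v ≠ 0 ∧ ∃ c d : ℂˣ, IsEigen v A c ∧ IsEigen v B d := by
  set f : Module.End ℂ (Fin 2 → ℂ) := Matrix.toLin' (A : Matrix (Fin 2) (Fin 2) ℂ) with hf
  set g : Module.End ℂ (Fin 2 → ℂ) := Matrix.toLin' (B : Matrix (Fin 2) (Fin 2) ℂ) with hg
  have hfg : Commute f g := by
    have h' : (A : Matrix (Fin 2) (Fin 2) ℂ) * B = B * A := by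
      rw [← Matrix.SpecialLinearGroup.coe_mul, ← Matrix.SpecialLinearGroup.coe_mul, h.eq]
    change f * g = g * f
    rw [Module.End.mul_eq_comp, Module.End.mul_eq_comp, hf, hg, ← Matrix.toLin'_mul,
      ← Matrix.toLin'_mul, h']
  obtain ⟨c, hc⟩ := Module.End.exists_eigenvalue f
  have hmaps : ∀ x ∈ f.eigenspace c, g x ∈ f.eigenspace c := fun x hx => by
    rw [Module.End.mem_eigenspace_iff] at hx ⊢
    rw [← Module.End.mul_apply, hfg.eq, Module.End.mul_apply, hx, map_smul]
  have : Nontrivial (f.eigenspace c) := Submodule.nontrivial_iff_ne_bot.2 hc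
  obtain ⟨d, hd⟩ := Module.End.exists_eigenvalue (g.restrict hmaps)
  obtain ⟨w, hw⟩ := hd.exists_hasEigenvector
  have hw0 : (w : Fin 2 → ℂ) ≠ 0 := fun h0 => hw.2 (Subtype.ext h0)
  have h1 : (A : Matrix (Fin 2) (Fin 2) ℂ).mulVec w = c • (w : Fin 2 → ℂ) := by
    simpa [hf] using Module.End.mem_eigenspace_iff.1 w.2
  have h2 : (B : Matrix (Fin 2) (Fin 2) ℂ).mulVec w = d • (w : Fin 2 → ℂ) := by
    have := congrArg Subtype.val hw.apply_eq_smul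
    simpa [hg] using this
  exact ⟨w, hw0, Units.mk0 c (ne_zero_of_mulVec hw0 h1), Units.mk0 d (ne_zero_of_mulVec hw0 h2),
    h1, h2⟩

/-! ### Characters of the torus group -/

/-- The element `λ ^ i * μ ^ j` of the torus group. -/
def torusElt (i j : ℤ) : TorusGroup := (Multiplicative.ofAdd i, Multiplicative.ofAdd j)

theorem torusElt_surj (g : TorusGroup) : ∃ i j, torusElt i j = g := ⟨g.1.toAdd, g.2.toAdd, rfl⟩

theorem torusHom_torusElt {Γ : Type*} [Group Γ] (x y : Γ) (h : Commute x y) (i j : ℤ) :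
    torusHom x y h (torusElt i j) = x ^ i * y ^ j := by
  simp [torusHom, torusElt, MonoidHom.noncommCoprod_apply]

theorem map_torusElt {Γ : Type*} [Group Γ] (φ : TorusGroup →* Γ) (i j : ℤ) :
    φ (torusElt i j) = φ (torusElt 1 0) ^ i * φ (torusElt 0 1) ^ j := by
  rw [← map_zpow, ← map_zpow, ← map_mul]
  congr 1
  ext <;> simp [torusElt, ← ofAdd_zsmul]

theorem isEigen_diagSL (z : ℂˣ) : IsEigen ![1, 0] (diagSL z) z := by
  unfold IsEigen diagSL
  ext i; fin_cases i <;> simp [Matrix.mulVec, dotProduct]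

theorem character_of_isEigen (ρ : TorusGroup →* SL2C) {v : Fin 2 → ℂ} (hv : v ≠ 0) {c d : ℂˣ}
    (hc : IsEigen v (ρ (torusElt 1 0)) c) (hd : IsEigen v (ρ (torusElt 0 1)) d) (i j : ℤ) :
    character ρ (torusElt i j) = ((c ^ i * d ^ j : ℂˣ) : ℂ) + (((c ^ i * d ^ j)⁻¹ : ℂˣ) : ℂ) := by
  unfold character
  rw [map_torusElt]
  exact ((hc.zpow i).mul (hd.zpow j)).trace_eq hv

theorem torusQuotient_torusElt (L M : ℂˣ) (i j : ℤ) :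
    (torusQuotient L M).1 (torusElt i j) =
      ((L ^ i * M ^ j : ℂˣ) : ℂ) + (((L ^ i * M ^ j)⁻¹ : ℂˣ) : ℂ) := by
  apply character_of_isEigen (v := ![1, 0])
  · intro h; simpa using congrFun h 0
  · rw [torusHom_torusElt]; simpa using isEigen_diagSL L
  · rw [torusHom_torusElt]; simpa using isEigen_diagSL M

/-- Traces in `SL₂` depend only on the eigenvalue on one eigenvector, so a representation of `ℤ²`
need not be diagonalizable to have the character of a diagonal one. -/
theorem torusQuotient_eq_of_isEigen (ρ : TorusGroup →* SL2C) {v : Fin 2 → ℂ} (hv : v ≠ 0)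
    {c d : ℂˣ} (hc : IsEigen v (ρ (torusElt 1 0)) c) (hd : IsEigen v (ρ (torusElt 0 1)) d) :
    (torusQuotient c d).1 = character ρ := by
  ext g
  obtain ⟨i, j, rfl⟩ := torusElt_surj g
  rw [torusQuotient_torusElt, character_of_isEigen ρ hv hc hd]

theorem torusQuotient_inv (L M : ℂˣ) : torusQuotient L⁻¹ M⁻¹ = torusQuotient L M := by
  apply Subtype.ext
  ext g
  obtain ⟨i, j, rfl⟩ := torusElt_surj g
  rw [torusQuotient_torusElt, torusQuotient_torusElt, add_comm]
  congr 2
  · simp [mul_comm]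
  · simp [mul_comm]

theorem torusQuotient_surjective (χ : CharacterVariety TorusGroup) :
    ∃ L M : ℂˣ, torusQuotient L M = χ := by
  obtain ⟨χ, ρ, rfl⟩ := χ
  have h : Commute (torusElt 1 0) (torusElt 0 1) := Commute.all _ _
  obtain ⟨v, hv, c, d, hc, hd⟩ := exists_common_eigenvector (h.map ρ)
  exact ⟨c, d, Subtype.ext (torusQuotient_eq_of_isEigen ρ hv hc hd)⟩

/-- The sum of a polynomial in the eigenvalues and its conjugate under inversion is a polynomial
in the characters. -/
theorem exists_symm_add (g : MvPolynomial (Fin 2) ℂ) : ∃ p : MvPolynomial TorusGroup ℂ,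
    ∀ L M : ℂˣ, MvPolynomial.eval (torusQuotient L M).1 p =
      MvPolynomial.eval ![(L : ℂ), (M : ℂ)] g +
        MvPolynomial.eval ![((L⁻¹ : ℂˣ) : ℂ), ((M⁻¹ : ℂˣ) : ℂ)] g := by
  refine ⟨∑ s ∈ g.support, MvPolynomial.C (g.coeff s) * MvPolynomial.X (torusElt (s 0) (s 1)),
    fun L M => ?_⟩
  rw [MvPolynomial.eval_eq' _ g, MvPolynomial.eval_eq' _ g, map_sum, ← Finset.sum_add_distrib]
  refine Finset.sum_congr rfl fun s _ => ?_
  rw [map_mul, MvPolynomial.eval_C, MvPolynomial.eval_X, torusQuotient_torusElt, ← mul_add]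
  congr 2
  · simp
  · simp [mul_comm]

/-- The product of a polynomial in the eigenvalues and its conjugate under inversion is a polynomial
in the characters. -/
theorem exists_symm_mul (g : MvPolynomial (Fin 2) ℂ) : ∃ p : MvPolynomial TorusGroup ℂ,
    ∀ L M : ℂˣ, MvPolynomial.eval (torusQuotient L M).1 p =
      MvPolynomial.eval ![(L : ℂ), (M : ℂ)] g *
        MvPolynomial.eval ![((L⁻¹ : ℂˣ) : ℂ), ((M⁻¹ : ℂˣ) : ℂ)] g := by
  -- The product is the sum over pairs `(s, t)` of a coefficient times a Laurent monomial with
  -- exponent `s - t`. Exchanging `s` and `t` inverts the monomial, so averaging over the exchange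
  -- turns each monomial into half a trace.
  refine ⟨∑ s ∈ g.support, ∑ t ∈ g.support, MvPolynomial.C (g.coeff s * g.coeff t / 2) *
    MvPolynomial.X (torusElt (s 0 - t 0) (s 1 - t 1)), fun L M => ?_⟩
  set F : (Fin 2 →₀ ℕ) → (Fin 2 →₀ ℕ) → ℂ := fun s t =>
    g.coeff s * g.coeff t * ((L : ℂ) ^ s 0 * (M : ℂ) ^ s 1 * ((L : ℂ) ^ t 0 * (M : ℂ) ^ t 1)⁻¹)
    with hF
  have h1 : MvPolynomial.eval ![(L : ℂ), (M : ℂ)] g *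
      MvPolynomial.eval ![((L⁻¹ : ℂˣ) : ℂ), ((M⁻¹ : ℂˣ) : ℂ)] g =
      ∑ s ∈ g.support, ∑ t ∈ g.support, F s t := by
    rw [MvPolynomial.eval_eq' _ g, MvPolynomial.eval_eq' _ g, Finset.sum_mul_sum]
    refine Finset.sum_congr rfl fun s _ => Finset.sum_congr rfl fun t _ => ?_
    simp [hF]
    ring
  have h2 : MvPolynomial.eval (torusQuotient L M).1 (∑ s ∈ g.support, ∑ t ∈ g.support,
      MvPolynomial.C (g.coeff s * g.coeff t / 2) *
      MvPolynomial.X (torusElt (s 0 - t 0) (s 1 - t 1))) =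
      ∑ s ∈ g.support, ∑ t ∈ g.support, (F s t / 2 + F t s / 2) := by
    rw [map_sum]
    refine Finset.sum_congr rfl fun s _ => ?_
    rw [map_sum]
    refine Finset.sum_congr rfl fun t _ => ?_
    rw [map_mul, MvPolynomial.eval_C, MvPolynomial.eval_X, torusQuotient_torusElt]
    have hL : (L : ℂ) ≠ 0 := L.ne_zero
    have hM : (M : ℂ) ≠ 0 := M.ne_zero
    simp only [hF, Units.val_inv_eq_inv_val, Units.val_mul, Units.val_zpow_eq_zpow_val,
      zpow_sub₀ hL, zpow_sub₀ hM, zpow_natCast]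
    field_simp
    try ring
  rw [h1, h2]
  simp only [Finset.sum_add_distrib]
  rw [Finset.sum_comm (f := fun s t => F t s / 2), ← Finset.sum_add_distrib]
  refine Finset.sum_congr rfl fun s _ => ?_
  rw [← Finset.sum_add_distrib]
  exact Finset.sum_congr rfl fun t _ => add_halves _

section

open TopologicalSpace

/-! ### The Zariski topology on character varieties -/

namespace CharacterVariety

variable {Γ Δ : Type*} [Group Γ] [Group Δ]

/-- The closed set defined by a polynomial in the characters. -/
def zeros (p : MvPolynomial Γ ℂ) : Set (CharacterVariety Γ) :=
  {χ | MvPolynomial.eval χ.1 p = 0}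

@[simp]
theorem mem_zeros {p : MvPolynomial Γ ℂ} {χ : CharacterVariety Γ} :
    χ ∈ zeros p ↔ MvPolynomial.eval χ.1 p = 0 := Iff.rfl

/-- Intersections of nonvanishing sets correspond to products of polynomials, so the generating
family is already a basis. A point outside a closed set is thus separated from it by a single
polynomial. -/
theorem isTopologicalBasis_ne_zero : IsTopologicalBasis
    {U | ∃ p : MvPolynomial Γ ℂ, U = {χ : CharacterVariety Γ | MvPolynomial.eval χ.1 p ≠ 0}} where
  exists_subset_inter := by
    rintro _ ⟨p, rfl⟩ _ ⟨q, rfl⟩ χ ⟨hp, hq⟩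
    refine ⟨_, ⟨p * q, rfl⟩, ?_, fun ψ hψ => ?_⟩
    · simpa using ⟨hp, hq⟩
    · simpa [not_or] using hψ
  sUnion_eq := Set.eq_univ_of_forall fun χ => ⟨_, ⟨1, rfl⟩, by simp⟩
  eq_generateFrom := rfl

theorem isClosed_zeros (p : MvPolynomial Γ ℂ) : IsClosed (zeros p) :=
  ⟨isTopologicalBasis_ne_zero.isOpen ⟨p, rfl⟩⟩

theorem exists_of_notMem_isClosed {Z : Set (CharacterVariety Γ)} (hZ : IsClosed Z)
    {χ : CharacterVariety Γ} (hχ : χ ∉ Z) :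
    ∃ p : MvPolynomial Γ ℂ, Z ⊆ zeros p ∧ χ ∉ zeros p := by
  obtain ⟨_, ⟨p, rfl⟩, h1, h2⟩ :=
    isTopologicalBasis_ne_zero.exists_subset_of_mem_open hχ hZ.isOpen_compl
  exact ⟨p, fun ψ hψ => by_contra fun hne => h2 hne hψ, h1⟩

theorem continuous_of_zeros {X : Type*} [TopologicalSpace X] {f : X → CharacterVariety Γ}
    (h : ∀ p, IsClosed (f ⁻¹' zeros p)) : Continuous f := by
  refine isTopologicalBasis_ne_zero.continuous_iff.2 ?_
  rintro _ ⟨p, rfl⟩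
  exact (h p).isOpen_compl

theorem isPreirreducible_of_zeros {T : Set (CharacterVariety Γ)}
    (h : ∀ p q : MvPolynomial Γ ℂ, T ⊆ zeros (p * q) → T ⊆ zeros p ∨ T ⊆ zeros q) :
    IsPreirreducible T := by
  rintro U V hU hV ⟨x, hxT, hxU⟩ ⟨y, hyT, hyV⟩
  obtain ⟨_, ⟨p, rfl⟩, hp, hpU⟩ := isTopologicalBasis_ne_zero.exists_subset_of_mem_open hxU hU
  obtain ⟨_, ⟨q, rfl⟩, hq, hqV⟩ := isTopologicalBasis_ne_zero.exists_subset_of_mem_open hyV hV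
  by_contra hne
  have : T ⊆ zeros (p * q) := fun z hz => by
    by_contra hz'
    simp only [mem_zeros, map_mul, mul_eq_zero, not_or] at hz'
    exact hne ⟨z, hz, hpU hz'.1, hqV hz'.2⟩
  rcases h p q this with h' | h'
  · exact hp (h' hxT)
  · exact hq (h' hyT)

/-- The image of a connected set under a family of characters that depends analytically on the
parameter is irreducible. -/
theorem isPreirreducible_image_of_analytic {U : Set ℂ} (hU : IsPreconnected U)
    (χ : ℂ → CharacterVariety Γ) (h : ∀ γ, AnalyticOnNhd ℂ (fun s => (χ s).1 γ) U) :
    IsPreirreducible (χ '' U) := by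
  have hA (p : MvPolynomial Γ ℂ) : AnalyticOnNhd ℂ (fun s => MvPolynomial.eval (χ s).1 p) U := by
    induction p using MvPolynomial.induction_on with
    | C a => simpa using analyticOnNhd_const
    | add p q hp hq => simpa using! hp.add hq
    | mul_X p g hp => simpa using! hp.mul (h g)
  refine isPreirreducible_of_zeros fun p q hpq => ?_
  have := AnalyticOnNhd.eq_zero_or_eq_zero_of_mul_eq_zero (hA p) (hA q)
    (fun s hs => by simpa using hpq ⟨s, hs, rfl⟩) hU
  simpa [Set.subset_def] using this

theorem isClosed_singleton (χ : CharacterVariety Γ) : IsClosed ({χ} : Set (CharacterVariety Γ)) := by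
  have : ({χ} : Set (CharacterVariety Γ)) =
      ⋂ γ : Γ, zeros (MvPolynomial.X γ - MvPolynomial.C (χ.1 γ)) := by
    ext ψ
    simp only [Set.mem_singleton_iff, Set.mem_iInter, mem_zeros, map_sub, MvPolynomial.eval_X,
      MvPolynomial.eval_C, sub_eq_zero]
    exact ⟨fun h γ => by rw [h], fun h => Subtype.ext (funext h)⟩
  rw [this]
  exact isClosed_iInter fun γ => isClosed_zeros _

instance : T1Space (CharacterVariety Γ) := ⟨isClosed_singleton⟩

theorem eval_restrict (φ : Δ →* Γ) (χ : CharacterVariety Γ) (p : MvPolynomial Δ ℂ) :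
    MvPolynomial.eval (restrict φ χ).1 p =
      MvPolynomial.eval χ.1 (MvPolynomial.rename φ p) := by
  rw [MvPolynomial.eval_rename]
  rfl

theorem continuous_restrict (φ : Δ →* Γ) : Continuous (restrict φ : CharacterVariety Γ → _) := by
  refine continuous_of_zeros fun p => ?_
  convert isClosed_zeros (MvPolynomial.rename φ p) using 1
  ext χ
  simp [eval_restrict]

end CharacterVariety

open CharacterVariety

/-! ### The dimension of subsets of the character variety of the torus -/

/-- The three traces that generate the coordinate ring of `X(∂N)`. -/
def torusTraces (χ : CharacterVariety TorusGroup) : Fin 3 → ℂ :=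
  ![χ.1 (torusElt 1 0), χ.1 (torusElt 0 1), χ.1 (torusElt 1 1)]

/-- The identity `tr(PQ) + tr(PQ⁻¹) = tr(P) tr(Q)` for commuting matrices. -/
theorem char_torusElt_rec (χ : CharacterVariety TorusGroup) (a b i j : ℤ) :
    χ.1 (torusElt (a + i) (b + j)) + χ.1 (torusElt (a - i) (b - j)) =
      χ.1 (torusElt i j) * χ.1 (torusElt a b) := by
  obtain ⟨L, M, rfl⟩ := torusQuotient_surjective χ
  have hL : (L : ℂ) ≠ 0 := L.ne_zero
  have hM : (M : ℂ) ≠ 0 := M.ne_zero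
  simp only [torusQuotient_torusElt, Units.val_inv_eq_inv_val, Units.val_mul,
    Units.val_zpow_eq_zpow_val, zpow_sub₀ hL, zpow_sub₀ hM, zpow_add₀ hL, zpow_add₀ hM]
  have := zpow_ne_zero a hL
  have := zpow_ne_zero i hL
  have := zpow_ne_zero b hM
  have := zpow_ne_zero j hM
  field_simp
  ring

/-- A family of functions indexed by `ℤ` that satisfies a two-term recursion with coefficients in
a subring lies in the subring if two consecutive members do. -/
theorem mem_of_two_term_rec {R S : Type*} [CommRing R] [SetLike S R] [SubringClass S R] (A : S)
    (w : ℤ → R) (c : R) (hc : c ∈ A) (h0 : w 0 ∈ A) (h1 : w 1 ∈ A)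
    (hrec : ∀ i, w (i + 1) + w (i - 1) = c * w i) (i : ℤ) : w i ∈ A := by
  suffices w i ∈ A ∧ w (i + 1) ∈ A from this.1
  induction i using Int.induction_on with
  | zero => exact ⟨h0, by simpa using h1⟩
  | succ i ih =>
    refine ⟨ih.2, ?_⟩
    have := hrec (i + 1)
    rw [add_sub_cancel_right] at this
    rw [eq_sub_of_add_eq this]
    exact sub_mem (mul_mem hc ih.2) ih.1
  | pred i ih =>
    refine ⟨?_, by simpa using ih.1⟩
    have := hrec (-i)
    rw [add_comm] at this
    rw [eq_sub_of_add_eq this]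
    exact sub_mem (mul_mem hc ih.1) ih.2

/-- The trace recursion in each of the two exponents generates all characters from the values at
`(0,0)`, `(1,0)`, `(0,1)`, `(1,1)`, the first of which is `2`. This brings the topology, defined
with infinitely many variables, into affine 3-space, where Krull dimension is available. -/
theorem exists_eval_torusTraces (p : MvPolynomial TorusGroup ℂ) : ∃ r : MvPolynomial (Fin 3) ℂ,
    ∀ χ : CharacterVariety TorusGroup,
      MvPolynomial.eval χ.1 p = MvPolynomial.eval (torusTraces χ) r := by
  set ev : MvPolynomial (Fin 3) ℂ →ₐ[ℂ] (CharacterVariety TorusGroup → ℂ) :=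
    AlgHom.pi fun χ => MvPolynomial.aeval (torusTraces χ) with hev
  set A := ev.range with hA
  have hX : ∀ i : Fin 3, (fun χ => torusTraces χ i) ∈ A := fun i =>
    ⟨MvPolynomial.X i, by ext χ; simp [hev]⟩
  set w : ℤ → ℤ → CharacterVariety TorusGroup → ℂ := fun i j χ => χ.1 (torusElt i j) with hw
  have h00 : w 0 0 ∈ A := by
    convert A.algebraMap_mem 2 using 1
    ext χ
    obtain ⟨L, M, rfl⟩ := torusQuotient_surjective χ
    simp only [hw, torusQuotient_torusElt]
    norm_num
  have h10 : w 1 0 ∈ A := hX 0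
  have h01 : w 0 1 ∈ A := hX 1
  have h11 : w 1 1 ∈ A := hX 2
  have hi (j : ℤ) (h0 : w 0 j ∈ A) (h1 : w 1 j ∈ A) (i : ℤ) : w i j ∈ A := by
    refine mem_of_two_term_rec A (fun i => w i j) (w 1 0) h10 h0 h1 (fun i => ?_) i
    ext χ
    simpa using char_torusElt_rec χ i j 1 0
  have hij (i j : ℤ) : w i j ∈ A := by
    refine mem_of_two_term_rec A (fun j => w i j) (w 0 1) h01 (hi 0 h00 h10 i) (hi 1 h01 h11 i)
      (fun j => ?_) j
    ext χ
    simpa using char_torusElt_rec χ i j 0 1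
  have hp : (fun χ : CharacterVariety TorusGroup => MvPolynomial.eval χ.1 p) ∈ A := by
    induction p using MvPolynomial.induction_on with
    | C a =>
      convert A.algebraMap_mem a using 1
      ext χ
      simp
    | add p q hp hq =>
      convert A.add_mem hp hq using 1
      ext χ
      simp
    | mul_X p g hp =>
      obtain ⟨i, j, rfl⟩ := torusElt_surj g
      convert A.mul_mem hp (hij i j) using 1
      ext χ
      simp [hw]
  obtain ⟨r, hr⟩ := hp
  refine ⟨r, fun χ => ?_⟩
  rw [← congrFun hr χ]
  simp [hev, MvPolynomial.aeval_eq_eval]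

/-- Fricke's formula for the trace of a commutator, which is `2` here. It puts `X(∂N)` on a surface
in 3-space. -/
theorem torusTraces_relation (χ : CharacterVariety TorusGroup) :
    torusTraces χ 0 ^ 2 + torusTraces χ 1 ^ 2 + torusTraces χ 2 ^ 2 -
      torusTraces χ 0 * torusTraces χ 1 * torusTraces χ 2 - 4 = 0 := by
  obtain ⟨L, M, rfl⟩ := torusQuotient_surjective χ
  have hL : (L : ℂ) ≠ 0 := L.ne_zero
  have hM : (M : ℂ) ≠ 0 := M.ne_zero
  simp only [torusTraces, torusQuotient_torusElt, Units.val_inv_eq_inv_val, Units.val_mul,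
    Units.val_one, zpow_one, zpow_zero, Matrix.cons_val]
  field_simp
  ring

/-- The ideal of the polynomials in the three traces that vanish on `Z`. -/
def tracesIdeal (Z : Set (CharacterVariety TorusGroup)) : Ideal (MvPolynomial (Fin 3) ℂ) :=
  MvPolynomial.vanishingIdeal ℂ (torusTraces '' Z)

theorem mem_tracesIdeal {Z : Set (CharacterVariety TorusGroup)} {r : MvPolynomial (Fin 3) ℂ} :
    r ∈ tracesIdeal Z ↔ ∀ χ ∈ Z, MvPolynomial.eval (torusTraces χ) r = 0 := by
  simp [tracesIdeal, MvPolynomial.mem_vanishingIdeal_iff, MvPolynomial.aeval_eq_eval]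

theorem continuous_torusTraces_zeros (r : MvPolynomial (Fin 3) ℂ) :
    IsClosed {χ | MvPolynomial.eval (torusTraces χ) r = 0} := by
  convert isClosed_zeros (MvPolynomial.bind₁ (![MvPolynomial.X (torusElt 1 0),
    MvPolynomial.X (torusElt 0 1), MvPolynomial.X (torusElt 1 1)] :
      Fin 3 → MvPolynomial TorusGroup ℂ) r) using 1
  ext χ
  have : MvPolynomial.eval (torusTraces χ) r = MvPolynomial.eval χ.1 (MvPolynomial.bind₁
      (![MvPolynomial.X (torusElt 1 0), MvPolynomial.X (torusElt 0 1),
        MvPolynomial.X (torusElt 1 1)] : Fin 3 → MvPolynomial TorusGroup ℂ) r) := by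
    refine Eq.trans ?_ (MvPolynomial.eval₂Hom_bind₁ (RingHom.id ℂ) χ.1 _ r).symm
    refine congrArg (fun v => MvPolynomial.eval₂Hom (RingHom.id ℂ) v r) (funext fun i => ?_)
    fin_cases i <;> simp [torusTraces]
  simp [this]

theorem isPrime_tracesIdeal {Z : Set (CharacterVariety TorusGroup)} (hZ : IsIrreducible Z) :
    (tracesIdeal Z).IsPrime := by
  refine ⟨?_, ?_⟩
  · intro h
    obtain ⟨χ, hχ⟩ := hZ.1
    have := mem_tracesIdeal.1 (h ▸ Submodule.mem_top : (1 : MvPolynomial (Fin 3) ℂ) ∈ _) χ hχ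
    simp at this
  · intro p q hpq
    have := isPreirreducible_iff_isClosed_union_isClosed.1 hZ.2 _ _
      (continuous_torusTraces_zeros p) (continuous_torusTraces_zeros q) (fun χ hχ => by
        simpa using mem_tracesIdeal.1 hpq χ hχ)
    exact this.imp (fun h => mem_tracesIdeal.2 h) (fun h => mem_tracesIdeal.2 h)

theorem tracesIdeal_anti {Z W : Set (CharacterVariety TorusGroup)} (h : Z ⊆ W) :
    tracesIdeal W ≤ tracesIdeal Z :=
  MvPolynomial.vanishingIdeal_anti_mono (Set.image_mono h)

/-- A polynomial that separates a point of `W` from the closed set `Z` can be written in the three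
traces. So chains of irreducible closed sets become strict chains of primes. -/
theorem tracesIdeal_lt {Z W : Set (CharacterVariety TorusGroup)} (hZ : IsClosed Z) (h : Z ⊂ W) :
    tracesIdeal W < tracesIdeal Z := by
  refine lt_of_le_not_ge (tracesIdeal_anti h.1) fun hle => ?_
  obtain ⟨χ, hχW, hχZ⟩ := Set.exists_of_ssubset h
  obtain ⟨p, hp, hpχ⟩ := exists_of_notMem_isClosed hZ hχZ
  obtain ⟨r, hr⟩ := exists_eval_torusTraces p
  refine hpχ ?_
  rw [mem_zeros, hr]
  exact mem_tracesIdeal.1 (hle (mem_tracesIdeal.2 fun ψ hψ => by rw [← hr]; exact hp hψ)) χ hχW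

/-- Any two points of `ℂˣ × ℂˣ` lie on an entire curve, obtained by interpolating logarithms. If a
product of two polynomials vanishes everywhere, one factor vanishes on the whole of such a curve. -/
theorem isIrreducible_univ_torus : IsIrreducible (Set.univ : Set (CharacterVariety TorusGroup)) := by
  refine ⟨⟨torusQuotient 1 1, trivial⟩, isPreirreducible_of_zeros fun p q hpq => ?_⟩
  by_contra! hne
  obtain ⟨⟨χ, -, hχ⟩, ⟨ψ, -, hψ⟩⟩ := And.intro (Set.not_subset.1 hne.1) (Set.not_subset.1 hne.2)
  obtain ⟨L, M, rfl⟩ := torusQuotient_surjective χ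
  obtain ⟨L', M', rfl⟩ := torusQuotient_surjective ψ
  set e : ℂ → ℂ → ℂ → ℂˣ := fun a b s =>
    Units.mk0 (Complex.exp (Complex.log a * (1 - s) + Complex.log b * s)) (Complex.exp_ne_zero _)
    with he
  have he0 (a b : ℂˣ) : e a b 0 = a := Units.ext (by simp [he, Complex.exp_log])
  have he1 (a b : ℂˣ) : e a b 1 = b := Units.ext (by simp [he, Complex.exp_log])
  have hA (a b : ℂ) : AnalyticOnNhd ℂ (fun s => ((e a b s : ℂˣ) : ℂ)) Set.univ := by
    simp only [he, Units.val_mk0]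
    exact (DifferentiableOn.analyticOnNhd (by fun_prop) isOpen_univ)
  have hT := isPreirreducible_image_of_analytic (U := Set.univ) isPreconnected_univ
    (fun s => torusQuotient (e L L' s) (e M M' s)) (fun g => by
      obtain ⟨i, j, rfl⟩ := torusElt_surj g
      simp only [torusQuotient_torusElt, Units.val_inv_eq_inv_val, Units.val_mul,
        Units.val_zpow_eq_zpow_val]
      have h1 := ((hA L L').zpow (n := i) fun s _ => (e L L' s).ne_zero).mul
        ((hA M M').zpow (n := j) fun s _ => (e M M' s).ne_zero)
      exact h1.add (h1.inv fun s _ => mul_ne_zero (zpow_ne_zero _ (e L L' s).ne_zero)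
        (zpow_ne_zero _ (e M M' s).ne_zero)))
  rcases isPreirreducible_iff_isClosed_union_isClosed.1 hT _ _ (isClosed_zeros p)
    (isClosed_zeros q) (fun χ _ => by simpa using hpq (Set.mem_univ χ)) with h | h
  · exact hχ (h ⟨0, trivial, by simp only [he0]⟩)
  · exact hψ (h ⟨1, trivial, by simp only [he1]⟩)

theorem tracesIdeal_univ_ne_bot : tracesIdeal Set.univ ≠ ⊥ := by
  intro h
  have hm : (MvPolynomial.X 0 ^ 2 + MvPolynomial.X 1 ^ 2 + MvPolynomial.X 2 ^ 2 -
      MvPolynomial.X 0 * MvPolynomial.X 1 * MvPolynomial.X 2 - MvPolynomial.C 4 :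
        MvPolynomial (Fin 3) ℂ) ∈ tracesIdeal Set.univ :=
    mem_tracesIdeal.2 fun χ _ => by simpa using torusTraces_relation χ
  rw [h, Ideal.mem_bot] at hm
  have := congrArg (MvPolynomial.eval (0 : Fin 3 → ℂ)) hm
  simp at this

/-- A closed set in `X(∂N)` on which a nonzero function vanishes is at most one-dimensional. -/
theorem topologicalKrullDim_le_one {Z : Set (CharacterVariety TorusGroup)} (hZ : IsClosed Z)
    (hne : Z ≠ Set.univ) : topologicalKrullDim Z ≤ 1 := by
  refine iSup_le fun s => ?_
  by_contra hlt
  have hlen : 2 ≤ s.length := by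
    by_contra hlen
    refine hlt ?_
    norm_cast
    omega
  set T : ℕ → Set (CharacterVariety TorusGroup) := fun i =>
    if h : i < s.length + 1 then Subtype.val '' (s ⟨i, h⟩ : Set Z) else ∅ with hT
  have hTs (i : ℕ) (h : i < s.length + 1) : T i = Subtype.val '' (s ⟨i, h⟩ : Set Z) := by
    simp only [hT, h, dif_pos]
  have hcl (i : ℕ) (h : i < s.length + 1) : IsClosed (T i) := by
    rw [hTs i h]
    exact hZ.isClosedEmbedding_subtypeVal.isClosedMap _ (s ⟨i, h⟩).isClosed
  have hirr (i : ℕ) (h : i < s.length + 1) : IsIrreducible (T i) := by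
    rw [hTs i h]
    exact (s ⟨i, h⟩).isIrreducible.image _ continuous_subtype_val.continuousOn
  have hlt (i j : ℕ) (hij : i < j) (h : j < s.length + 1) : T i ⊂ T j := by
    rw [hTs j h, hTs i (hij.trans h)]
    have := s.strictMono (show (⟨i, hij.trans h⟩ : Fin (s.length + 1)) < ⟨j, h⟩ from hij)
    exact Subtype.val_injective.image_strictMono this
  have hu : T 2 ⊂ Set.univ := by
    refine (Set.subset_univ _).ssubset_of_ne fun h => hne (Set.eq_univ_of_univ_subset ?_)
    rw [← h, hTs 2 (by omega)]
    rintro _ ⟨x, -, rfl⟩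
    exact x.2
  -- Three nested irreducible closed subsets of `Z`, preceded in the chain of primes by the zero
  -- ideal and the ideal of all of `X(∂N)`, would give a chain of length 4 in a ring of dimension 3.
  have : ((4 : ℕ) : WithBot ℕ∞) ≤ ringKrullDim (MvPolynomial (Fin 3) ℂ) := by
    let P : Fin 5 → PrimeSpectrum (MvPolynomial (Fin 3) ℂ) := ![⟨⊥, Ideal.isPrime_bot⟩,
      ⟨_, isPrime_tracesIdeal isIrreducible_univ_torus⟩,
      ⟨_, isPrime_tracesIdeal (hirr 2 (by omega))⟩, ⟨_, isPrime_tracesIdeal (hirr 1 (by omega))⟩,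
      ⟨_, isPrime_tracesIdeal (hirr 0 (by omega))⟩]
    refine Order.le_krullDim_iff.2 ⟨⟨4, P, fun i => ?_⟩, rfl⟩
    fin_cases i
    · exact bot_lt_iff_ne_bot.2 tracesIdeal_univ_ne_bot
    · exact tracesIdeal_lt (hcl 2 (by omega)) hu
    · exact tracesIdeal_lt (hcl 1 (by omega)) (hlt 1 2 (by omega) (by omega))
    · exact tracesIdeal_lt (hcl 0 (by omega)) (hlt 0 1 (by omega) (by omega))
  rw [MvPolynomial.ringKrullDim_of_isNoetherianRing, ringKrullDim_eq_zero_of_field] at this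
  simp only [Nat.card_eq_fintype_card, Fintype.card_fin, zero_add] at this
  norm_cast at this

/-- Points are closed, so a point inside `Z` is a chain of length one. -/
theorem one_le_topologicalKrullDim {Γ : Type*} [Group Γ] {Z : Set (CharacterVariety Γ)}
    (hZ : IsIrreducible Z) (h : Z.Nontrivial) : 1 ≤ topologicalKrullDim Z := by
  obtain ⟨x, hx, y, hy, hxy⟩ := h
  have : IrreducibleSpace Z := isIrreducible_iff_irreducibleSpace.1 hZ
  refine Order.one_le_krullDim_iff.2 ⟨⟨{⟨x, hx⟩}, isIrreducible_singleton, _root_.isClosed_singleton⟩,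
    ⟨Set.univ, IrreducibleSpace.isIrreducible_univ Z, isClosed_univ⟩, ?_⟩
  refine (Set.subset_univ _).ssubset_of_ne fun h => hxy ?_
  have : (⟨y, hy⟩ : Z) ∈ ({⟨x, hx⟩} : Set Z) := Set.eq_univ_iff_forall.1 h _
  exact (congrArg Subtype.val this).symm

theorem topologicalKrullDim_ne_one_of_subsingleton {X : Type*} [TopologicalSpace X]
    [Subsingleton X] : topologicalKrullDim X ≠ 1 := by
  have : topologicalKrullDim X ≤ 0 := topologicalKrullDim_zero_of_discreteTopology X
  intro h
  rw [h] at this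
  exact absurd this (by norm_num)

end

section

open CharacterVariety MvPolynomial

/-! ### The vanishing ideal of the eigenvalue curve is principal -/

section

variable {Γ : Type*} [Group Γ] {φ : TorusGroup →* Γ}

theorem vec_mem_eigenvalueCurve {L M : ℂˣ} :
    ![(L : ℂ), (M : ℂ)] ∈ eigenvalueCurve φ ↔ torusQuotient L M ∈ imageCurve φ := by
  constructor
  · rintro ⟨L', M', h, hm⟩
    have h0 : L = L' := Units.ext (congrFun h 0)
    have h1 : M = M' := Units.ext (congrFun h 1)
    rwa [h0, h1]
  · exact fun h => ⟨L, M, rfl, h⟩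

/-- The eigenvalue curve has no isolated points. -/
theorem eigenvalueCurve_infinite {g : MvPolynomial (Fin 2) ℂ} {v : Fin 2 → ℂ}
    (hv : v ∈ eigenvalueCurve φ) (hg : eval v g ≠ 0) :
    {w ∈ eigenvalueCurve φ | eval w g ≠ 0}.Infinite := by
  intro hfin
  obtain ⟨L, M, rfl, hLM⟩ := hv
  -- `g` itself is not a function on `X(∂N)`, since it need not be invariant under inversion. Of its
  -- symmetrizations, the sum is nonzero at the given point if `g` vanishes at the inverse point,
  -- and the product is nonzero otherwise.
  obtain ⟨p, hpv, hp⟩ : ∃ p : MvPolynomial TorusGroup ℂ, eval (torusQuotient L M).1 p ≠ 0 ∧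
      ∀ L M : ℂˣ, eval (torusQuotient L M).1 p ≠ 0 → eval ![(L : ℂ), (M : ℂ)] g ≠ 0 ∨
        eval ![((L⁻¹ : ℂˣ) : ℂ), ((M⁻¹ : ℂˣ) : ℂ)] g ≠ 0 := by
    by_cases h : eval ![((L⁻¹ : ℂˣ) : ℂ), ((M⁻¹ : ℂˣ) : ℂ)] g = 0
    · obtain ⟨p, hp⟩ := exists_symm_add g
      refine ⟨p, by rwa [hp, h, add_zero], fun L M hLM => ?_⟩
      by_contra! hne
      rw [hp, hne.1, hne.2, add_zero] at hLM
      exact hLM rfl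
    · obtain ⟨p, hp⟩ := exists_symm_mul g
      refine ⟨p, by rw [hp]; exact mul_ne_zero hg h, fun L M hLM => Or.inl fun hne => ?_⟩
      rw [hp, hne, zero_mul] at hLM
      exact hLM rfl
  set K : Set (CharacterVariety TorusGroup) :=
    {χ | ∃ L M : ℂˣ, torusQuotient L M = χ ∧
      ![(L : ℂ), (M : ℂ)] ∈ {w ∈ eigenvalueCurve φ | eval w g ≠ 0}} with hK
  have hKfin : K.Finite := by
    refine (hfin.image fun w => if h : w 0 ≠ 0 ∧ w 1 ≠ 0 then
      torusQuotient (Units.mk0 (w 0) h.1) (Units.mk0 (w 1) h.2) else torusQuotient 1 1).subset ?_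
    rintro _ ⟨L, M, rfl, h⟩
    refine ⟨_, h, ?_⟩
    have : (![(L : ℂ), (M : ℂ)] : Fin 2 → ℂ) 0 ≠ 0 ∧ (![(L : ℂ), (M : ℂ)] : Fin 2 → ℂ) 1 ≠ 0 :=
      ⟨L.ne_zero, M.ne_zero⟩
    simp only [this, ne_eq, not_false_eq_true, and_self, dif_pos]
    congr 1 <;> exact Units.ext rfl
  obtain ⟨X, hX, χ, hχ, hχv⟩ := Set.mem_iUnion₂.1 hLM
  -- If only finitely many points of the curve avoid `g`, two closed sets cover the irreducible
  -- component `X`. The first misses `χ`, so `X` restricts into the finite set `K`; the image is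
  -- finite and irreducible, hence a point, which contradicts dimension one.
  have hcover : X ⊆ restrict φ ⁻¹' zeros p ∪ restrict φ ⁻¹' K := by
    intro ψ hψ
    by_cases hψp : restrict φ ψ ∈ zeros p
    · exact Or.inl hψp
    right
    obtain ⟨L', M', h⟩ := torusQuotient_surjective (restrict φ ψ)
    have hmem : torusQuotient L' M' ∈ imageCurve φ :=
      Set.mem_iUnion₂.2 ⟨X, hX, ψ, hψ, h.symm⟩
    rw [← h] at hψp
    rcases hp _ _ hψp with h1 | h1
    · exact ⟨L', M', h, vec_mem_eigenvalueCurve.2 hmem, h1⟩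
    · refine ⟨L'⁻¹, M'⁻¹, by rw [torusQuotient_inv, h], vec_mem_eigenvalueCurve.2 ?_, h1⟩
      rwa [torusQuotient_inv]
  have hXirr : IsIrreducible X := hX.1.1
  have hmem : restrict φ χ ∉ zeros p := by rwa [hχv]
  rcases isPreirreducible_iff_isClosed_union_isClosed.1 hXirr.2 _ _
    ((isClosed_zeros p).preimage (continuous_restrict φ))
    (hKfin.isClosed.preimage (continuous_restrict φ)) hcover with h | h
  · exact hmem (h hχ)
  · have hfinX : (restrict φ '' X).Finite := hKfin.subset (Set.image_subset_iff.2 h)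
    have hirr := hXirr.image _ (continuous_restrict φ).continuousOn
    have hsub : (restrict φ '' X).Subsingleton := by
      have := hfinX.isDiscrete
      exact this.subsingleton_of_isPreirreducible hirr.2
    have hcl : (closure (restrict φ '' X)).Subsingleton := hsub.closure
    have : Subsingleton (closure (restrict φ '' X)) := hcl.coe_sort
    exact topologicalKrullDim_ne_one_of_subsingleton hX.2.2

end

/-- The zero set of an ideal of `ℂ[X, Y]` that lies in no proper principal ideal is finite. -/
theorem finite_zeros_of_no_common_factor {J : Ideal (MvPolynomial (Fin 2) ℂ)} (hJ : J ≠ ⊥)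
    (h : ∀ π : MvPolynomial (Fin 2) ℂ, Prime π → ¬ J ≤ Ideal.span {π}) :
    (zeroLocus ℂ J).Finite := by
  have hfin := J.finite_minimalPrimes_of_isNoetherianRing
  refine Set.Finite.of_finite_image (f := fun v => vanishingIdeal ℂ ({v} : Set (Fin 2 → ℂ)))
    (hfin.subset ?_) ?_
  · rintro _ ⟨v, hv, rfl⟩
    have hle : J ≤ vanishingIdeal ℂ ({v} : Set (Fin 2 → ℂ)) := fun p hp => by
      rw [mem_vanishingIdeal_singleton_iff]
      exact hv p hp
    obtain ⟨P, hP, hPle⟩ := Ideal.exists_minimalPrimes_le hle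
    have hPp : P.IsPrime := hP.1.1
    have hPbot : P ≠ ⊥ := fun hb => hJ (le_bot_iff.1 (hb ▸ hP.1.2))
    obtain ⟨π, hπP, hπ⟩ := hPp.exists_mem_prime_of_ne_bot hPbot
    have hlt : Ideal.span {π} < P := lt_of_le_of_ne
      ((Ideal.span_singleton_le_iff_mem _).2 hπP) fun he => h π hπ (he ▸ hP.1.2)
    rcases hPle.eq_or_lt with he | hlt'
    · simpa only [← he] using hP
    exfalso
    -- If the ideal of `v` were not itself a minimal prime of `J`, then `0 < (π) < P < I(v)` would
    -- be too long a chain in dimension 2. So the zeros of `J` inject into its finitely many minimal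
    -- primes.
    have : ((3 : ℕ) : WithBot ℕ∞) ≤ ringKrullDim (MvPolynomial (Fin 2) ℂ) := by
      let Q : Fin 4 → PrimeSpectrum (MvPolynomial (Fin 2) ℂ) := ![⟨⊥, Ideal.isPrime_bot⟩,
        ⟨_, (Ideal.span_singleton_prime hπ.ne_zero).2 hπ⟩, ⟨P, hPp⟩,
        ⟨vanishingIdeal ℂ ({v} : Set (Fin 2 → ℂ)), inferInstance⟩]
      refine Order.le_krullDim_iff.2 ⟨⟨3, Q, fun i => ?_⟩, rfl⟩
      fin_cases i
      · exact bot_lt_iff_ne_bot.2 fun hb => hπ.ne_zero (Ideal.span_singleton_eq_bot.1 hb)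
      · exact hlt
      · exact hlt'
    rw [MvPolynomial.ringKrullDim_of_isNoetherianRing, ringKrullDim_eq_zero_of_field] at this
    simp only [Nat.card_eq_fintype_card, Fintype.card_fin, zero_add] at this
    norm_cast at this
  · intro v _ w _ hvw
    ext i
    have : (X i - C (v i) : MvPolynomial (Fin 2) ℂ) ∈ vanishingIdeal ℂ ({v} : Set (Fin 2 → ℂ)) := by
      rw [mem_vanishingIdeal_singleton_iff]; simp
    rw [show vanishingIdeal ℂ ({v} : Set (Fin 2 → ℂ)) = vanishingIdeal ℂ {w} from hvw,
      mem_vanishingIdeal_singleton_iff] at this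
    simpa [sub_eq_zero, eq_comm] using this

/-- The vanishing ideal of a plane set without isolated points is principal. -/
theorem exists_span_eq_vanishingIdeal {V : Set (Fin 2 → ℂ)} (h0 : vanishingIdeal ℂ V ≠ ⊥)
    (hV : ∀ (g : MvPolynomial (Fin 2) ℂ), ∀ v ∈ V, eval v g ≠ 0 →
      {w ∈ V | eval w g ≠ 0}.Infinite) :
    ∃ g, Ideal.span {g} = vanishingIdeal ℂ V := by
  set I := vanishingIdeal ℂ V with hI
  obtain ⟨Q, hQI, hQ0⟩ := Submodule.exists_mem_ne_zero_of_ne_bot h0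
  -- a cofactor of `Q` that is minimal for divisibility
  obtain ⟨r, ⟨g, hgr, hIg⟩, hmin⟩ := (IsWellFounded.wf
    (r := DvdNotUnit (α := MvPolynomial (Fin 2) ℂ))).has_min
    {r | ∃ g, Q = g * r ∧ I ≤ Ideal.span {g}} ⟨Q, 1, by simp, by simp⟩
  have hr0 : r ≠ 0 := by rintro rfl; simp [hQ0] at hgr
  set J : Ideal (MvPolynomial (Fin 2) ℂ) :=
    Submodule.comap (LinearMap.mulLeft (MvPolynomial (Fin 2) ℂ) g) I
  have hmemJ (p) : p ∈ J ↔ g * p ∈ I := Iff.rfl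
  have hrJ : r ∈ J := by rw [hmemJ, ← hgr]; exact hQI
  -- `J` is the quotient ideal `(I : g)`. A prime `π` dividing all of `J` could be moved from the
  -- cofactor `r` into `g`, against the minimality of `r`. Points of `V` where `g ≠ 0` are zeros of
  -- `J`, so there are finitely many, hence none.
  have hfin := finite_zeros_of_no_common_factor (J := J)
    (fun hb => hr0 (by simpa [hb] using hrJ)) (fun π hπ hle => by
      obtain ⟨s, hs⟩ := Ideal.mem_span_singleton.1 (hle hrJ)
      refine hmin s ⟨g * π, by rw [hgr, hs]; ring, fun p hp => ?_⟩
        ⟨fun h => hr0 (by rw [hs, h, mul_zero]), π, hπ.not_isUnit, by rw [hs]; ring⟩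
      obtain ⟨t, rfl⟩ := Ideal.mem_span_singleton.1 (hIg hp)
      obtain ⟨u, rfl⟩ := Ideal.mem_span_singleton.1 (hle ((hmemJ t).2 hp))
      exact Ideal.mem_span_singleton.2 ⟨u, by ring⟩)
  refine ⟨g, le_antisymm ((Ideal.span_singleton_le_iff_mem _).2 fun v hv => ?_) hIg⟩
  rw [aeval_eq_eval]
  by_contra hne
  refine hV g v hv hne (hfin.subset ?_)
  rintro w ⟨hw, hwg⟩ p hp
  have := hp w hw
  rw [LinearMap.mulLeft_apply, map_mul, aeval_eq_eval] at this
  rw [aeval_eq_eval]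
  exact (mul_eq_zero.1 this).resolve_left hwg

end

section

open CharacterVariety MvPolynomial

/-! ### Automorphisms of `ℂ` acting on character varieties -/

section

variable {Γ Δ : Type*} [Group Γ] [Group Δ]

/-- The entrywise action of a field automorphism on `SL₂(ℂ)`. -/
def twistSL (σ : ℂ ≃+* ℂ) : SL2C →* SL2C := Matrix.SpecialLinearGroup.map (σ : ℂ →+* ℂ)

theorem character_twistSL (σ : ℂ ≃+* ℂ) (ρ : Γ →* SL2C) (γ : Γ) :
    character ((twistSL σ).comp ρ) γ = σ (character ρ γ) := by
  simp [character, twistSL, Matrix.trace_fin_two]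

/-- The preimage of an invariant subspace under the semilinear bijection induced by `σ` is an
invariant subspace for `ρ`. -/
theorem IsIrreducibleRep.twist {ρ : Γ →* SL2C} (h : IsIrreducibleRep ρ) (σ : ℂ ≃+* ℂ) :
    IsIrreducibleRep ((twistSL σ).comp ρ) := by
  intro W hW
  let W' : Submodule ℂ (Fin 2 → ℂ) :=
    { carrier := {v | (fun i => σ (v i)) ∈ W}
      add_mem' := fun {a b} ha hb => by
        simpa only [Set.mem_ofPred_eq, Pi.add_apply, map_add] using! W.add_mem ha hb
      zero_mem' := by simpa only [Set.mem_ofPred_eq, Pi.zero_apply, map_zero] using! W.zero_mem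
      smul_mem' := fun c v hv => by
        simpa only [Set.mem_ofPred_eq, Pi.smul_apply, smul_eq_mul, map_mul] using!
          W.smul_mem (σ c) hv }
  have hmem (v) : v ∈ W' ↔ (fun i => σ (v i)) ∈ W := Iff.rfl
  have hsurj (w : Fin 2 → ℂ) : (fun i => σ ((fun i => σ.symm (w i)) i)) = w := by ext; simp
  rcases h W' (fun γ v hv => by
    rw [hmem] at hv ⊢
    convert hW γ _ hv using 1
    ext i
    simp [twistSL, Matrix.mulVec, dotProduct]) with h' | h'
  · left
    rw [Submodule.eq_bot_iff] at h' ⊢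
    intro w hw
    have := h' (fun i => σ.symm (w i)) (by rw [hmem, hsurj]; exact hw)
    ext i
    simpa using congrFun this i
  · right
    rw [Submodule.eq_top_iff'] at h' ⊢
    intro w
    rw [← hsurj w]
    exact h' _

/-- The action of a field automorphism on the character variety. -/
def CharacterVariety.twist (σ : ℂ ≃+* ℂ) (χ : CharacterVariety Γ) : CharacterVariety Γ :=
  ⟨fun γ => σ (χ.1 γ), by
    obtain ⟨χ, ρ, rfl⟩ := χ
    exact ⟨(twistSL σ).comp ρ, funext fun γ => character_twistSL σ ρ γ⟩⟩

theorem eval_twist (σ : ℂ ≃+* ℂ) (χ : CharacterVariety Γ) (p : MvPolynomial Γ ℂ) :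
    eval (χ.twist σ).1 p = σ (eval χ.1 (map (σ.symm : ℂ →+* ℂ) p)) := by
  rw [eval_map, ← RingEquiv.coe_toRingHom, hom_eval₂]
  have : (σ : ℂ →+* ℂ).comp (σ.symm : ℂ →+* ℂ) = RingHom.id ℂ := by ext; simp
  rw [this]
  rfl

theorem continuous_twist (σ : ℂ ≃+* ℂ) :
    Continuous (CharacterVariety.twist σ : CharacterVariety Γ → CharacterVariety Γ) := by
  refine continuous_of_zeros fun p => ?_
  convert isClosed_zeros (map (σ.symm : ℂ →+* ℂ) p) using 1
  ext χ
  simp [eval_twist]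

/-- The action of a field automorphism on the character variety is a homeomorphism. -/
def twistHomeomorph (σ : ℂ ≃+* ℂ) : CharacterVariety Γ ≃ₜ CharacterVariety Γ where
  toFun := CharacterVariety.twist σ
  invFun := CharacterVariety.twist σ.symm
  left_inv χ := Subtype.ext (funext fun γ => by simp [CharacterVariety.twist])
  right_inv χ := Subtype.ext (funext fun γ => by simp [CharacterVariety.twist])
  continuous_toFun := continuous_twist σ
  continuous_invFun := continuous_twist σ.symm

theorem restrict_twist (φ : Δ →* Γ) (σ : ℂ ≃+* ℂ) (χ : CharacterVariety Γ) :
    restrict φ (χ.twist σ) = (restrict φ χ).twist σ := rfl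

theorem image_mem_irreducibleComponents {X Y : Type*} [TopologicalSpace X] [TopologicalSpace Y]
    (f : X ≃ₜ Y) {Z : Set X} (hZ : Z ∈ irreducibleComponents X) :
    f '' Z ∈ irreducibleComponents Y := by
  refine ⟨hZ.1.image _ f.continuous.continuousOn, fun W hW hle => ?_⟩
  have h1 : IsIrreducible (f.symm '' W) := hW.image _ f.symm.continuous.continuousOn
  have h2 : Z ≤ f.symm '' W := fun z hz => ⟨f z, hle ⟨z, hz, rfl⟩, by simp⟩
  intro w hw
  exact ⟨f.symm w, hZ.2 h1 h2 ⟨w, hw, rfl⟩, by simp⟩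

/-- A field automorphism acts by homeomorphisms that commute with restriction and preserve
irreducibility of representations, so it permutes the components that define `D`. -/
theorem image_twist_mem_curveComponents {φ : TorusGroup →* Γ} {X : Set (CharacterVariety Γ)}
    (hX : X ∈ curveComponents φ) (σ : ℂ ≃+* ℂ) :
    CharacterVariety.twist σ '' X ∈ curveComponents φ := by
  obtain ⟨hirr, ⟨ρ, hρ, χ, hχ, hχρ⟩, hdim⟩ := hX
  refine ⟨image_mem_irreducibleComponents (twistHomeomorph σ) hirr,
    ⟨_, hρ.twist σ, _, ⟨χ, hχ, rfl⟩, ?_⟩, ?_⟩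
  · ext γ
    rw [character_twistSL, ← hχρ]
    rfl
  · have himg : closure (restrict φ '' (CharacterVariety.twist σ '' X)) =
        twistHomeomorph σ '' closure (restrict φ '' X) := by
      rw [(twistHomeomorph σ).image_closure, Set.image_image, Set.image_image]
      rfl
    rw [himg, ← hdim]
    exact (((twistHomeomorph σ).image _).isHomeomorph.topologicalKrullDim_eq _).symm

theorem twist_mem_eigenvalueCurve {φ : TorusGroup →* Γ} {v : Fin 2 → ℂ}
    (hv : v ∈ eigenvalueCurve φ) (σ : ℂ ≃+* ℂ) : (fun i => σ (v i)) ∈ eigenvalueCurve φ := by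
  obtain ⟨L, M, rfl, h⟩ := hv
  obtain ⟨X, hX, χ, hχ, hχv⟩ := Set.mem_iUnion₂.1 h
  refine ⟨Units.map (σ : ℂ →* ℂ) L, Units.map (σ : ℂ →* ℂ) M, ?_, ?_⟩
  · ext i
    fin_cases i <;> simp
  · refine Set.mem_iUnion₂.2 ⟨_, image_twist_mem_curveComponents hX σ, _, ⟨χ, hχ, rfl⟩, ?_⟩
    rw [restrict_twist, hχv]
    apply Subtype.ext
    ext g
    obtain ⟨i, j, rfl⟩ := torusElt_surj g
    simp only [CharacterVariety.twist, torusQuotient_torusElt]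
    simp

end

/-! ### The fixed field of the automorphism group of `ℂ` -/

/-- A permutation of the basis is an automorphism of the polynomial ring it generates, and `ℂ` is an
algebraic closure over that ring. -/
theorem swap_isTranscendenceBasis_equiv {ι : Type} {v : ι → ℂ} (hv : IsTranscendenceBasis ℚ v)
    (e : ι ≃ ι) : ∃ σ : ℂ ≃+* ℂ, ∀ i, σ (v i) = v (e i) := by
  have := IsAlgClosed.isAlgClosure_of_transcendence_basis v hv
  let f : Algebra.adjoin ℚ (Set.range v) ≃+* Algebra.adjoin ℚ (Set.range v) :=
    (hv.1.aevalEquiv.symm.trans ((renameEquiv ℚ e).trans hv.1.aevalEquiv)).toRingEquiv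
  refine ⟨IsAlgClosure.equivOfEquiv ℂ ℂ f, fun i => ?_⟩
  have h := IsAlgClosure.equivOfEquiv_algebraMap ℂ ℂ f (hv.1.aevalEquiv (X i))
  simpa [f, hv.1.algebraMap_aevalEquiv] using h

/-- A transcendental `c` belongs to a transcendence basis and can be swapped with another basis
element. -/
theorem isAlgebraic_of_fixed {c : ℂ} (hc : ∀ σ : ℂ ≃+* ℂ, σ c = c) : IsAlgebraic ℚ c := by
  by_contra htr
  have hind : AlgebraicIndepOn ℚ id ({c} : Set ℂ) :=
    by
    refine (algebraicIndependent_singleton_iff (⟨c, rfl⟩ : ({c} : Set ℂ))).2 ?_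
    exact htr
  obtain ⟨s, hs, hbasis⟩ := exists_isTranscendenceBasis_superset hind
  -- The basis has the cardinality of the continuum, which ensures an element other than `c`.
  have hcard := IsAlgClosed.cardinal_eq_cardinal_transcendence_basis_of_aleph0_lt' _ hbasis
    (Cardinal.mkRat.le) (by rw [Cardinal.mk_complex]; exact Cardinal.aleph0_lt_continuum)
  obtain ⟨b, hb⟩ : ∃ b : s, (b : ℂ) ≠ c := by
    by_contra! h
    have : Subsingleton s := ⟨fun x y => Subtype.ext ((h x).trans (h y).symm)⟩
    have h1 : Cardinal.mk s ≤ 1 := Cardinal.le_one_iff_subsingleton.2 this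
    rw [← hcard, Cardinal.mk_complex] at h1
    exact absurd (Cardinal.one_lt_aleph0.trans Cardinal.aleph0_lt_continuum) (not_lt.2 h1)
  classical
  obtain ⟨σ, hσ⟩ := swap_isTranscendenceBasis_equiv hbasis (Equiv.swap ⟨c, hs rfl⟩ b)
  have := hσ ⟨c, hs rfl⟩
  rw [Equiv.swap_apply_left, hc] at this
  exact hb this.symm

/-- The base field is algebraically closed in a purely transcendental extension. -/
theorem mem_range_of_isIntegral_adjoin {F E ι : Type*} [Field F] [Field E] [Algebra F E] {v : ι → E}
    (hv : AlgebraicIndependent F v) {k : IntermediateField.adjoin F (Set.range v)}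
    (hk : IsIntegral F k) : ∃ q : F, algebraMap F _ q = k := by
  have hy : IsIntegral (MvPolynomial ι F) (hv.aevalEquivField.symm k) :=
    (hk.map hv.aevalEquivField.symm).tower_top
  obtain ⟨p, hp⟩ := IsIntegrallyClosed.isIntegral_iff.1 hy
  have hpc : Polynomial.aeval p (minpoly F k) = 0 := by
    apply FaithfulSMul.algebraMap_injective (MvPolynomial ι F) (FractionRing (MvPolynomial ι F))
    rw [map_zero, ← Polynomial.aeval_algebraMap_apply, hp]
    apply hv.aevalEquivField.injective
    have e1 := Polynomial.aeval_algHom_apply hv.aevalEquivField.toAlgHom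
        (hv.aevalEquivField.symm k) (minpoly F k)
    rw [map_zero]
    refine Eq.trans e1.symm ?_
    simp
  -- The polynomial `p` that represents `k` satisfies the minimal polynomial of `k` over `F`. Taking
  -- constant terms yields a root in `F`, so the irreducible minimal polynomial is linear.
  have hroot : (minpoly F k).IsRoot (constantCoeff p) := by
    have h := congrArg (constantCoeff (R := F)) hpc
    rw [map_zero, Polynomial.aeval_def, Polynomial.hom_eval₂] at h
    have e : (constantCoeff (R := F) (σ := ι)).comp (algebraMap F (MvPolynomial ι F)) =
        RingHom.id F := RingHom.ext fun x => by simp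
    rw [e] at h
    exact h
  have hdeg := Polynomial.degree_eq_one_of_irreducible_of_root (minpoly.irreducible hk) hroot
  exact minpoly.mem_range_of_degree_eq_one F k hdeg

/-- A complex number that is fixed by all automorphisms of `ℂ` is rational. -/
theorem mem_range_rat_of_fixed {c : ℂ} (hc : ∀ σ : ℂ ≃+* ℂ, σ c = c) : ∃ q : ℚ, (q : ℂ) = c := by
  have halg := isAlgebraic_of_fixed hc
  have hint : IsIntegral ℚ c := halg.isIntegral
  obtain ⟨s, hs⟩ := exists_isTranscendenceBasis ℚ ℂ
  have h1 := hs.isAlgebraic_field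
  -- Over `K`, generated by a transcendence basis, `ℂ` is Galois, so the fixed number `c` lies in
  -- `K`. Since it is also algebraic over `ℚ`, and `K` is purely transcendental, it is rational.
  set K := IntermediateField.adjoin ℚ (Set.range ((↑) : s → ℂ))
  have : IsAlgClosure K ℂ := ⟨inferInstance, h1⟩
  have : Normal K ℂ := IsAlgClosure.normal K ℂ
  have : IsGalois K ℂ := {}
  obtain ⟨k, hk⟩ := (InfiniteGalois.mem_range_algebraMap_iff_fixed (k := K) c).2
    fun f => hc f.toRingEquiv
  have hkint : IsIntegral ℚ k := by
    rw [← hk] at hint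
    exact (isIntegral_algebraMap_iff (algebraMap K ℂ).injective).1 hint
  obtain ⟨q, hq⟩ := mem_range_of_isIntegral_adjoin hs.1 hkint
  refine ⟨q, ?_⟩
  rw [← hk, ← hq]
  simp

/-! ### Descent of the generator to integer coefficients. -/

/-- A plane set that is stable under `Aut(ℂ)` and has a principal vanishing ideal is cut out by a
primitive integer polynomial. -/
theorem exists_primitive_int_generator {V : Set (Fin 2 → ℂ)}
    (hV : ∀ v ∈ V, ∀ σ : ℂ ≃+* ℂ, (fun i => σ (v i)) ∈ V) (h0 : vanishingIdeal ℂ V ≠ ⊥)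
    {g : MvPolynomial (Fin 2) ℂ} (hg : Ideal.span {g} = vanishingIdeal ℂ V) :
    ∃ A : MvPolynomial (Fin 2) ℤ,
      Ideal.span {map (Int.castRingHom ℂ) A} = vanishingIdeal ℂ V ∧
      ∀ d : ℤ, (∀ s, d ∣ A.coeff s) → IsUnit d := by
  have hg0 : g ≠ 0 := by
    rintro rfl
    exact h0 (by rw [← hg]; simp)
  obtain ⟨s₀, hs₀⟩ := MvPolynomial.ne_zero_iff.1 hg0
  have hgV : ∀ v ∈ V, eval v g = 0 := fun v hv =>
    (hg ▸ Ideal.mem_span_singleton_self g : g ∈ vanishingIdeal ℂ V) v hv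
  have hrat (s) : ∃ q : ℚ, (q : ℂ) = g.coeff s / g.coeff s₀ := by
    refine mem_range_rat_of_fixed fun σ => ?_
    have hmem : map (σ : ℂ →+* ℂ) g ∈ Ideal.span {g} := by
      rw [hg]
      intro v hv
      rw [aeval_eq_eval, eval_map]
      have h1 := hgV _ (hV v hv σ.symm)
      have h2 := congrArg (σ : ℂ →+* ℂ) h1
      rw [← eval₂_id, hom_eval₂] at h2
      simpa [Function.comp_def] using! h2
    obtain ⟨u, hu⟩ := Ideal.mem_span_singleton.1 hmem
    have hmap0 : map (σ : ℂ →+* ℂ) g ≠ 0 := fun h =>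
      hg0 ((map_injective _ (σ : ℂ →+* ℂ).injective) (by rw [h, map_zero]))
    have hu0 : u ≠ 0 := by
      rintro rfl
      exact hmap0 (by rw [hu, mul_zero])
    -- The conjugate of `g` by `σ` has the same support as `g`, so its cofactor is a constant.
    -- Ratios of coefficients of `g` are therefore fixed by every `σ`.
    have hdeg : u.totalDegree = 0 := by
      have h1 := totalDegree_mul_of_isDomain hg0 hu0
      rw [← hu] at h1
      have h2 : (map (σ : ℂ →+* ℂ) g).totalDegree = g.totalDegree := by
        rw [totalDegree, totalDegree, support_map_of_injective _ (σ : ℂ →+* ℂ).injective]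
      omega
    rw [totalDegree_eq_zero_iff_eq_C.1 hdeg] at hu
    have hc (s) : σ (g.coeff s) = g.coeff s * u.coeff 0 := by
      have := congrArg (coeff s) hu
      rwa [coeff_map, mul_comm g, coeff_C_mul, mul_comm] at this
    have hu1 : u.coeff 0 ≠ 0 := fun h => by
      have := hc s₀
      rw [h, mul_zero] at this
      exact hs₀ (σ.injective (by rw [this, map_zero]))
    rw [map_div₀, hc, hc, mul_div_mul_right _ _ hu1]
  choose q hq using hrat
  classical
  obtain ⟨b, hb⟩ := IsLocalization.exist_integer_multiples_of_finset (nonZeroDivisors ℤ)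
    (g.support.image q)
  have hb0 : ((b : ℤ) : ℂ) ≠ 0 := by exact_mod_cast nonZeroDivisors.ne_zero b.2
  have hint (s) : ∃ m : ℤ, (m : ℂ) = b * (g.coeff s / g.coeff s₀) := by
    by_cases hs : s ∈ g.support
    · obtain ⟨m, hm⟩ := hb (q s) (Finset.mem_image_of_mem q hs)
      refine ⟨m, ?_⟩
      rw [← hq s]
      have := congrArg (fun x : ℚ => (x : ℂ)) hm
      simpa using this
    · refine ⟨0, ?_⟩
      rw [notMem_support_iff.1 hs]
      simp
  choose m hm using hint
  obtain ⟨r, hr, hr1⟩ := Finset.extract_gcd m (support_nonempty.2 hg0)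
  set A : MvPolynomial (Fin 2) ℤ := ∑ s ∈ g.support, monomial s (r s) with hA
  set G : ℤ := g.support.gcd m with hG
  have hAc (s) (hs : s ∈ g.support) : A.coeff s = r s := by
    rw [hA, coeff_sum, Finset.sum_eq_single_of_mem s hs fun t _ hts => by rw [coeff_monomial, if_neg hts],
      coeff_monomial, if_pos rfl]
  have hG0 : (G : ℂ) ≠ 0 := by
    intro h
    have h1 := hr s₀ (mem_support_iff.2 hs₀)
    have h2 := hm s₀
    rw [h1, Int.cast_mul, h, zero_mul, div_self hs₀, mul_one] at h2
    exact hb0 h2.symm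
  have hmapA : map (Int.castRingHom ℂ) A = C ((b : ℂ) / (g.coeff s₀ * G)) * g := by
    ext s
    rw [coeff_map, coeff_C_mul]
    by_cases hs : s ∈ g.support
    · have h2 := hm s
      rw [hr s hs, Int.cast_mul] at h2
      rw [hAc s hs, eq_intCast]
      field_simp
      field_simp at h2
      linear_combination h2
    · have : A.coeff s = 0 := by
        rw [hA, coeff_sum]
        refine Finset.sum_eq_zero fun t ht => ?_
        rw [coeff_monomial, if_neg]
        rintro rfl
        exact hs ht
      rw [this, notMem_support_iff.1 hs]
      simp
  refine ⟨A, ?_, fun d hd => ?_⟩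
  · rw [hmapA, ← hg]
    refine Ideal.span_singleton_eq_span_singleton.2 ?_
    refine associated_unit_mul_left _ _ (IsUnit.map C (IsUnit.mk0 _ ?_))
    exact div_ne_zero hb0 (mul_ne_zero hs₀ hG0)
  · refine isUnit_of_dvd_one ?_
    rw [← hr1]
    exact Finset.dvd_gcd fun s hs => by rw [← hAc s hs]; exact hd s

end

/-! ### Trace identities for the figure-eight knot group -/

section

variable {R : Type*} [Ring R] [Algebra ℂ R]

/-- The combination of `1`, `A`, `B`, `A * B` with the given coefficients. -/
def comb (A B : R) (e : Fin 4 → ℂ) : R :=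
  e 0 • (1 : R) + e 1 • A + e 2 • B + e 3 • (A * B)

variable {A B : R} {x z : ℂ}

/-- `1`, `A`, `B`, `AB` span a space closed under right multiplication by `A` and `B`, so words can
be evaluated letter by letter on coordinate vectors. The rule for `BA` is `AB⁻¹ + (AB⁻¹)⁻¹ = z` with
`A⁻¹ = x - A` and `B⁻¹ = x - B`; thus `z` plays the role of the trace of `AB⁻¹`. -/
theorem comb_mul_left (hA : A * A = x • A - 1)
    (hBA : B * A = x • A + x • B - A * B - z • (1 : R)) (e : Fin 4 → ℂ) :
    comb A B e * A = comb A B ![-e 1 - z * e 2 - x * e 3, e 0 + x * e 1 + x * e 2 + (x ^ 2 - z) * e 3,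
      x * e 2 + e 3, -e 2] := by
  have hABA : A * B * A = (x ^ 2 - z) • A - x • (1 : R) + B := by
    rw [mul_assoc, hBA, mul_sub, mul_sub, mul_add, mul_smul_comm, mul_smul_comm, ← mul_assoc, hA,
      sub_mul, one_mul, smul_mul_assoc, mul_smul_comm, mul_one]
    module
  simp only [comb, add_mul, smul_mul_assoc, one_mul, hA, hBA, hABA, Matrix.cons_val]
  module

theorem comb_mul_right (hB : B * B = x • B - 1) (e : Fin 4 → ℂ) :
    comb A B e * B = comb A B ![-e 2, -e 3, e 0 + x * e 2, e 1 + x * e 3] := by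
  have hABB : A * B * B = x • (A * B) - A := by
    rw [mul_assoc, hB, mul_sub, mul_smul_comm, mul_one]
  simp only [comb, add_mul, smul_mul_assoc, one_mul, hB, hABB, Matrix.cons_val]
  module

theorem comb_mul_left_inv (hA : A * A = x • A - 1)
    (hBA : B * A = x • A + x • B - A * B - z • (1 : R)) (e : Fin 4 → ℂ) :
    comb A B e * (x • (1 : R) - A) = comb A B ![x * e 0 + e 1 + z * e 2 + x * e 3,
      -e 0 - x * e 2 - (x ^ 2 - z) * e 3, -e 3, x * e 3 + e 2] := by
  rw [mul_sub, comb_mul_left hA hBA, mul_smul_comm, mul_one]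
  simp only [comb, Matrix.cons_val]
  module

theorem comb_mul_right_inv (hB : B * B = x • B - 1) (e : Fin 4 → ℂ) :
    comb A B e * (x • (1 : R) - B) = comb A B ![x * e 0 + e 2, x * e 1 + e 3, -e 0, -e 1] := by
  rw [mul_sub, comb_mul_right hB, mul_smul_comm, mul_one]
  simp only [comb, Matrix.cons_val]
  module

theorem comb_word (hA : A * A = x • A - 1) (hB : B * B = x • B - 1)
    (hBA : B * A = x • A + x • B - A * B - z • (1 : R)) :
    (x • (1 : R) - B) * A * B * (x • (1 : R) - A) =
      comb A B ![z ^ 2 - x ^ 2 * z + 2 * x ^ 2 - 1, -x, -x, z] := by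
  have h1 : (x • (1 : R) - B) = comb A B ![x, 0, -1, 0] := by
    simp only [comb, Matrix.cons_val]; module
  rw [h1, comb_mul_left hA hBA, comb_mul_right hB, comb_mul_left_inv hA hBA]
  congr 1
  ext i
  fin_cases i <;> simp <;> ring

/-- The relator of the figure-eight knot group in terms of its Riley polynomial. -/
theorem relator_eq_smul (hA : A * A = x • A - 1) (hB : B * B = x • B - 1)
    (hBA : B * A = x • A + x • B - A * B - z • (1 : R)) :
    A * ((x • (1 : R) - B) * A * B * (x • (1 : R) - A)) -
      (x • (1 : R) - B) * A * B * (x • (1 : R) - A) * B =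
        (z ^ 2 - (x ^ 2 - 1) * z + x ^ 2 - 1) • (A - B) := by
  have h1 : A * (x • (1 : R) - B) = comb A B ![0, x, 0, -1] := by
    simp only [comb, Matrix.cons_val, mul_sub, mul_smul_comm, mul_one]; module
  have h2 : A * ((x • (1 : R) - B) * A * B * (x • (1 : R) - A)) =
      A * (x • (1 : R) - B) * A * B * (x • (1 : R) - A) := by noncomm_ring
  rw [h2, h1, comb_mul_left hA hBA, comb_mul_right hB, comb_mul_left_inv hA hBA, comb_word hA hB hBA,
    comb_mul_right hB]
  simp only [comb, Matrix.cons_val]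
  module

/-- The longitude in terms of the meridian, on the zero set of the Riley polynomial. -/
theorem longitude_eq_comb (hA : A * A = x • A - 1) (hB : B * B = x • B - 1)
    (hBA : B * A = x • A + x • B - A * B - z • (1 : R))
    (hR : z ^ 2 - (x ^ 2 - 1) * z + x ^ 2 - 1 = 0) :
    (x • (1 : R) - B) * A * B * (x • (1 : R) - A) *
      ((x • (1 : R) - A) * B * A * (x • (1 : R) - B)) =
      ((x ^ 4 - 5 * x ^ 2 + 2 - x ^ 2 * (2 * z - x ^ 2 + 1)) / 2) • (1 : R) +
        (x * (2 * z - x ^ 2 + 1)) • A := by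
  have h2 : (x • (1 : R) - B) * A * B * (x • (1 : R) - A) *
      ((x • (1 : R) - A) * B * A * (x • (1 : R) - B)) =
      (x • (1 : R) - B) * A * B * (x • (1 : R) - A) *
      (x • (1 : R) - A) * B * A * (x • (1 : R) - B) := by simp only [mul_assoc]
  have h3 : ((x ^ 4 - 5 * x ^ 2 + 2 - x ^ 2 * (2 * z - x ^ 2 + 1)) / 2) • (1 : R) +
        (x * (2 * z - x ^ 2 + 1)) • A = comb A B ![(x ^ 4 - 5 * x ^ 2 + 2 - x ^ 2 *
          (2 * z - x ^ 2 + 1)) / 2, x * (2 * z - x ^ 2 + 1), 0, 0] := by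
    simp [comb]
  rw [h2, h3, comb_word hA hB hBA, comb_mul_left_inv hA hBA, comb_mul_right hB,
    comb_mul_left hA hBA, comb_mul_right_inv hB]
  congr 1
  ext i
  fin_cases i
  · simp
    linear_combination (-x ^ 2 * z + 3 * x ^ 2) * hR
  · simp
    linear_combination (-x) * hR
  · simp
    linear_combination (x * z - 2 * x) * hR
  · simp
    ring

end


/-! ### The figure-eight trace identities in `SL₂(ℂ)`. -/

theorem coe_inv_eq (A : SL2C) : ((A⁻¹ : SL2C) : Matrix (Fin 2) (Fin 2) ℂ) =
    Matrix.trace (A : Matrix (Fin 2) (Fin 2) ℂ) • (1 : Matrix (Fin 2) (Fin 2) ℂ) - A := by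
  rw [Matrix.SpecialLinearGroup.coe_inv, Matrix.adjugate_fin_two, Matrix.trace_fin_two]
  ext i j
  fin_cases i <;> fin_cases j <;> simp

theorem coe_mul_self (A : SL2C) : (A : Matrix (Fin 2) (Fin 2) ℂ) * A =
    Matrix.trace (A : Matrix (Fin 2) (Fin 2) ℂ) • (A : Matrix (Fin 2) (Fin 2) ℂ) - 1 := by
  have h : (A : Matrix (Fin 2) (Fin 2) ℂ) * ((A⁻¹ : SL2C) : Matrix (Fin 2) (Fin 2) ℂ) = 1 := by
    rw [← Matrix.SpecialLinearGroup.coe_mul, mul_inv_cancel, Matrix.SpecialLinearGroup.coe_one]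
  rw [coe_inv_eq, mul_sub, mul_smul_comm, mul_one] at h
  rw [← h]
  abel

theorem coe_mul_swap {A B : SL2C} {x : ℂ} (hA : Matrix.trace (A : Matrix (Fin 2) (Fin 2) ℂ) = x)
    (hB : Matrix.trace (B : Matrix (Fin 2) (Fin 2) ℂ) = x) :
    (B : Matrix (Fin 2) (Fin 2) ℂ) * A = x • (A : Matrix (Fin 2) (Fin 2) ℂ) +
      x • (B : Matrix (Fin 2) (Fin 2) ℂ) - A * B -
      Matrix.trace ((A * B⁻¹ : SL2C) : Matrix (Fin 2) (Fin 2) ℂ) • (1 : Matrix (Fin 2) (Fin 2) ℂ) := by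
  have h := coe_inv_eq (A * B⁻¹)
  rw [mul_inv_rev, inv_inv, Matrix.SpecialLinearGroup.coe_mul, coe_inv_eq A, hA, mul_sub, mul_smul_comm,
    mul_one] at h
  have h2 : ((A * B⁻¹ : SL2C) : Matrix (Fin 2) (Fin 2) ℂ) =
      x • (A : Matrix (Fin 2) (Fin 2) ℂ) - A * B := by
    rw [Matrix.SpecialLinearGroup.coe_mul, coe_inv_eq B, hB, mul_sub, mul_smul_comm, mul_one]
  have h3 : (B : Matrix (Fin 2) (Fin 2) ℂ) * A = x • (B : Matrix (Fin 2) (Fin 2) ℂ) -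
      (x • (B : Matrix (Fin 2) (Fin 2) ℂ) - B * A) := by abel
  rw [h3, h]
  nth_rewrite 2 [h2]
  abel

/-- The two sides of the relation differ by the Riley polynomial times `A - B`. The first
alternative is the abelian case. -/
theorem figEight_relator_iff {A B : SL2C} {x z : ℂ}
    (hA : Matrix.trace (A : Matrix (Fin 2) (Fin 2) ℂ) = x) (hB : Matrix.trace (B : Matrix (Fin 2) (Fin 2) ℂ) = x)
    (hz : Matrix.trace ((A * B⁻¹ : SL2C) : Matrix (Fin 2) (Fin 2) ℂ) = z) :
    A * figEightWord A B = figEightWord A B * B ↔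
      A = B ∨ z ^ 2 - (x ^ 2 - 1) * z + x ^ 2 - 1 = 0 := by
  have hr := relator_eq_smul (hA ▸ coe_mul_self A) (hB ▸ coe_mul_self B)
    (hz ▸ coe_mul_swap hA hB)
  have hW : ((figEightWord A B : SL2C) : Matrix (Fin 2) (Fin 2) ℂ) =
      (x • (1 : Matrix (Fin 2) (Fin 2) ℂ) - B) * A * B * (x • (1 : Matrix (Fin 2) (Fin 2) ℂ) - A) := by
    simp only [figEightWord, Matrix.SpecialLinearGroup.coe_mul, coe_inv_eq, hA, hB]
  rw [← hW, ← Matrix.SpecialLinearGroup.coe_mul, ← Matrix.SpecialLinearGroup.coe_mul] at hr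
  have e1 : A * figEightWord A B = figEightWord A B * B ↔
      (A * figEightWord A B).1 = (figEightWord A B * B).1 := Subtype.ext_iff
  have e2 : A = B ↔ A.1 = B.1 := Subtype.ext_iff
  rw [e1, e2, ← sub_eq_zero, hr, smul_eq_zero, or_comm, sub_eq_zero]

theorem coe_longitude {A B : SL2C} {x z : ℂ}
    (hA : Matrix.trace (A : Matrix (Fin 2) (Fin 2) ℂ) = x) (hB : Matrix.trace (B : Matrix (Fin 2) (Fin 2) ℂ) = x)
    (hz : Matrix.trace ((A * B⁻¹ : SL2C) : Matrix (Fin 2) (Fin 2) ℂ) = z)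
    (hR : z ^ 2 - (x ^ 2 - 1) * z + x ^ 2 - 1 = 0) :
    ((figEightWord A B * figEightWordStar A B : SL2C) : Matrix (Fin 2) (Fin 2) ℂ) =
      ((x ^ 4 - 5 * x ^ 2 + 2 - x ^ 2 * (2 * z - x ^ 2 + 1)) / 2) •
        (1 : Matrix (Fin 2) (Fin 2) ℂ) +
        (x * (2 * z - x ^ 2 + 1)) • (A : Matrix (Fin 2) (Fin 2) ℂ) := by
  rw [← longitude_eq_comb (hA ▸ coe_mul_self A) (hB ▸ coe_mul_self B)
    (hz ▸ coe_mul_swap hA hB) hR]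
  simp only [figEightWord, figEightWordStar, Matrix.SpecialLinearGroup.coe_mul, coe_inv_eq, hA, hB]

/-- The trace of the longitude of the figure-eight knot: the defining equation of the
A-polynomial of the knot. -/
theorem trace_longitude {A B : SL2C} (h : A * figEightWord A B = figEightWord A B * B) :
    Matrix.trace ((figEightWord A B * figEightWordStar A B : SL2C) : Matrix (Fin 2) (Fin 2) ℂ) = 2 ∨
    Matrix.trace ((figEightWord A B * figEightWordStar A B : SL2C) : Matrix (Fin 2) (Fin 2) ℂ) =
      Matrix.trace (A : Matrix (Fin 2) (Fin 2) ℂ) ^ 4 - 5 * Matrix.trace (A : Matrix (Fin 2) (Fin 2) ℂ) ^ 2 + 2 := by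
  have hB : Matrix.trace (B : Matrix (Fin 2) (Fin 2) ℂ) = Matrix.trace (A : Matrix (Fin 2) (Fin 2) ℂ) := by
    have : B = (figEightWord A B)⁻¹ * (A * figEightWord A B) := by rw [h]; group
    nth_rewrite 1 [this]
    rw [Matrix.SpecialLinearGroup.coe_mul, Matrix.trace_mul_comm, ← Matrix.SpecialLinearGroup.coe_mul, mul_assoc,
      mul_inv_cancel, mul_one]
  rcases (figEight_relator_iff rfl hB rfl).1 h with rfl | hR
  · left
    simp [figEightWord, figEightWordStar]
  · right
    -- The terms with `2 * z - x ^ 2 + 1` cancel in the trace, so it depends on `x` alone.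
    rw [coe_longitude rfl hB rfl hR, Matrix.trace_add, Matrix.trace_smul, Matrix.trace_smul, Matrix.trace_one]
    simp
    ring

section

open CharacterVariety

/-! ### Relations in the group of the glued manifold -/

/-- The inclusion of `Γ₁` into `Γ_n`. -/
def knotToGlued (n : ℕ) : FigEightGroup →* GluedGroup n :=
  (QuotientGroup.mk' (Subgroup.normalClosure (gluingRelators n))).comp Monoid.Coprod.inl

/-- The second generator of the figure-eight knot group. -/
def figEightY : FigEightGroup := PresentedGroup.of FigEightGen.y

theorem map_figEightWord {G H : Type*} [Group G] [Group H] (f : G →* H) (a b : G) :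
    f (figEightWord a b) = figEightWord (f a) (f b) := by simp [figEightWord]

theorem map_figEightWordStar {G H : Type*} [Group G] [Group H] (f : G →* H) (a b : G) :
    f (figEightWordStar a b) = figEightWordStar (f a) (f b) := by simp [figEightWordStar]

theorem longitude_eq : longitude =
    figEightWord meridian figEightY * figEightWordStar meridian figEightY := rfl

theorem figEight_relation :
    meridian * figEightWord meridian figEightY = figEightWord meridian figEightY * figEightY := by
  have h := PresentedGroup.one_of_mem (rels := {FreeGroup.of FigEightGen.mu *
    figEightWord (FreeGroup.of FigEightGen.mu) (FreeGroup.of FigEightGen.y) *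
      (figEightWord (FreeGroup.of FigEightGen.mu) (FreeGroup.of FigEightGen.y) *
        FreeGroup.of FigEightGen.y)⁻¹}) rfl
  exact mul_inv_eq_one.mp h

theorem glue_linkL (n : ℕ) :
    knotToGlued n (meridian ^ 4 * longitude) = linkToGlued n (linkL n) := by
  have h := (QuotientGroup.eq_one_iff _).2 (Subgroup.subset_normalClosure (Set.mem_insert
    (Monoid.Coprod.inl (meridian ^ 4 * longitude) * (Monoid.Coprod.inr (linkL n))⁻¹)
    {Monoid.Coprod.inl (meridian ^ 3 * longitude) * (Monoid.Coprod.inr (linkM n))⁻¹}))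
  exact mul_inv_eq_one.mp h

theorem glue_linkM (n : ℕ) :
    knotToGlued n (meridian ^ 3 * longitude) = linkToGlued n (linkM n) := by
  have h := (QuotientGroup.eq_one_iff _).2 (Subgroup.subset_normalClosure (Set.mem_insert_of_mem
    (Monoid.Coprod.inl (meridian ^ 4 * longitude) * (Monoid.Coprod.inr (linkL n))⁻¹)
    (Set.mem_singleton
    (Monoid.Coprod.inl (meridian ^ 3 * longitude) * (Monoid.Coprod.inr (linkM n))⁻¹))))
  exact mul_inv_eq_one.mp h

theorem linkM_commute_pow (n : ℕ) : Commute ((linkA n * linkM n) ^ n) (linkM n) := by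
  have h := (linkA_commute_pow n).inv_right.mul_right
    ((Commute.refl (linkA n * linkM n)).pow_left n)
  rwa [inv_mul_cancel_left] at h

/-! ### The eigenvalues of representations of the glued group -/

/-- Two elements of `SL₂(ℂ)` that commute with a noncentral element commute. -/
theorem central_or_commute {A B C : SL2C} (hA : Commute C A) (hB : Commute C B) :
    (∃ ε : ℂˣ, ε ^ 2 = 1 ∧ ∀ v, IsEigen v C ε) ∨ Commute A B := by
  have hA' : (C : Matrix (Fin 2) (Fin 2) ℂ) * A = A * C := congrArg Subtype.val hA.eq
  have hB' : (C : Matrix (Fin 2) (Fin 2) ℂ) * B = B * C := congrArg Subtype.val hB.eq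
  have hdet := C.2
  rw [Matrix.det_fin_two] at hdet
  obtain ⟨c1, c2, c3, c4, hC⟩ : ∃ c1 c2 c3 c4, (C : Matrix (Fin 2) (Fin 2) ℂ) = !![c1, c2; c3, c4] :=
    ⟨_, _, _, _, Matrix.eta_fin_two _⟩
  obtain ⟨a1, a2, a3, a4, hAe⟩ : ∃ c1 c2 c3 c4, (A : Matrix (Fin 2) (Fin 2) ℂ) = !![c1, c2; c3, c4] :=
    ⟨_, _, _, _, Matrix.eta_fin_two _⟩
  obtain ⟨b1, b2, b3, b4, hBe⟩ : ∃ c1 c2 c3 c4, (B : Matrix (Fin 2) (Fin 2) ℂ) = !![c1, c2; c3, c4] :=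
    ⟨_, _, _, _, Matrix.eta_fin_two _⟩
  rw [hC, hAe, Matrix.mul_fin_two, Matrix.mul_fin_two] at hA'
  rw [hC, hBe, Matrix.mul_fin_two, Matrix.mul_fin_two] at hB'
  rw [hC] at hdet
  have p1 := congrFun (congrFun hA' 0) 0
  have p2 := congrFun (congrFun hA' 0) 1
  have p3 := congrFun (congrFun hA' 1) 0
  have q1 := congrFun (congrFun hB' 0) 0
  have q2 := congrFun (congrFun hB' 0) 1
  have q3 := congrFun (congrFun hB' 1) 0
  simp only [Matrix.of_apply, Matrix.cons_val', Matrix.cons_val_zero, Matrix.cons_val_one,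
    Matrix.cons_val_fin_one] at p1 p2 p3 q1 q2 q3 hdet
  by_cases hsc : c2 = 0 ∧ c3 = 0 ∧ c1 = c4
  · obtain ⟨rfl, rfl, rfl⟩ := hsc
    left
    have h1 : c1 * c1 = 1 := by linear_combination hdet
    have h0 : c1 ≠ 0 := left_ne_zero_of_mul_eq_one h1
    refine ⟨Units.mk0 c1 h0, Units.ext (by simpa [sq] using h1), fun v => ?_⟩
    unfold IsEigen
    rw [hC]
    ext i
    fin_cases i <;> simp [Matrix.mulVec, dotProduct]
  right
  -- Commuting with the nonscalar `C` makes the trace-free parts of `A` and `B` multiples of that of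
  -- `C`. The three equations say that these parts are parallel, which is equivalent to commuting.
  have key : a2 * b3 = b2 * a3 ∧ a2 * (b1 - b4) = b2 * (a1 - a4) ∧
      a3 * (b1 - b4) = b3 * (a1 - a4) := by
    by_cases h2 : c2 = 0
    · by_cases h3 : c3 = 0
      · have h4 : c1 - c4 ≠ 0 := fun h => hsc ⟨h2, h3, sub_eq_zero.1 h⟩
        subst h2 h3
        have ha2 : a2 = 0 :=
          (mul_eq_zero.1 (by linear_combination p2 : (c1 - c4) * a2 = 0)).resolve_left h4
        have ha3 : a3 = 0 :=
          (mul_eq_zero.1 (by linear_combination -p3 : (c1 - c4) * a3 = 0)).resolve_left h4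
        have hb2 : b2 = 0 :=
          (mul_eq_zero.1 (by linear_combination q2 : (c1 - c4) * b2 = 0)).resolve_left h4
        have hb3 : b3 = 0 :=
          (mul_eq_zero.1 (by linear_combination -q3 : (c1 - c4) * b3 = 0)).resolve_left h4
        simp [ha2, ha3, hb2, hb3]
      · refine ⟨?_, ?_, ?_⟩ <;> apply mul_left_cancel₀ (mul_ne_zero h3 h3)
        · linear_combination c3 * b3 * (-p1) + c3 * a3 * q1
        · linear_combination c2 * a3 * q3 - c3 * (b1 - b4) * p1 - c2 * b3 * p3 + c3 * (a1 - a4) * q1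
        · linear_combination c3 * a3 * q3 - c3 * b3 * p3
    · refine ⟨?_, ?_, ?_⟩ <;> apply mul_left_cancel₀ (mul_ne_zero h2 h2)
      · linear_combination c2 * a2 * q1 - c2 * b2 * p1
      · linear_combination c2 * b2 * p2 - c2 * a2 * q2
      · linear_combination c2 * (b1 - b4) * p1 - c2 * (a1 - a4) * q1 + c3 * b2 * p2 - c3 * a2 * q2
  apply Subtype.ext
  change (A : Matrix (Fin 2) (Fin 2) ℂ) * B = (B : Matrix (Fin 2) (Fin 2) ℂ) * A
  rw [hAe, hBe, Matrix.mul_fin_two, Matrix.mul_fin_two]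
  obtain ⟨k1, k2, k3⟩ := key
  ext i j
  fin_cases i <;> fin_cases j <;> simp
  · linear_combination k1
  · linear_combination -k2
  · linear_combination k3
  · linear_combination -k1

/-- The defining equation of the A-polynomial curve of the figure-eight knot in the coordinates
`t = μ³ λ` and `z = μ⁴ λ`, with denominators cleared. -/
def knotCurve (R : Type*) [CommRing R] (t z : R) : R :=
  t ^ 8 * z + z ^ 7 - z ^ 8 + t ^ 2 * z ^ 6 + 2 * t ^ 4 * z ^ 4 + t ^ 6 * z ^ 2 - t ^ 8

/-- This is the source of the equation of the boundary curve. The three alternatives are: `(am)^n`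
central, `a` and `m` commuting with longitude trace `2`, and `a` and `m` commuting with the other
trace of `trace_longitude`. In the last two, `t` is the eigenvalue of `m`. -/
theorem exists_eigenvalues {n : ℕ} (ρ : GluedGroup n →* SL2C) :
    ∃ v : Fin 2 → ℂ, v ≠ 0 ∧ ∃ X Y : ℂˣ, IsEigen v (ρ (linkToGlued n (linkScriptL n))) X ∧
      IsEigen v (ρ (linkToGlued n (linkA n))) Y ∧
      ((X : ℂ) ^ 2 * (Y : ℂ) ^ (2 * n) = 1 ∨ ∃ t : ℂ, t ^ n = X ∧
        (t ^ 4 = (Y : ℂ) ^ (3 * n) ∨ knotCurve ℂ t ((Y : ℂ) ^ n) = 0)) := by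
  set a := ρ (linkToGlued n (linkA n)) with ha
  set m := ρ (linkToGlued n (linkM n)) with hm
  have hSL : ρ (linkToGlued n (linkScriptL n)) = (a * m) ^ n * (a ^ n)⁻¹ := by
    simp [linkScriptL, ha, hm]
  have hLL : ρ (linkToGlued n (linkL n)) = (a * m) ^ n * (m ^ n)⁻¹ := by
    simp [linkL, ha, hm]
  have hca : Commute ((a * m) ^ n) a := by
    simpa [ha, hm] using ((linkA_commute_pow n).map (linkToGlued n)).map ρ
  have hcm : Commute ((a * m) ^ n) m := by
    simpa [ha, hm] using ((linkM_commute_pow n).map (linkToGlued n)).map ρ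
  rcases central_or_commute hca hcm with ⟨ε, hε, hC⟩ | hcomm
  · obtain ⟨v, hv, Y, _, hY, -⟩ := exists_common_eigenvector (Commute.refl a)
    have hX := (hC v).mul (hY.pow n).inv
    rw [← hSL] at hX
    refine ⟨v, hv, _, Y, hX, hY, Or.inl ?_⟩
    have : (ε : ℂ) ^ 2 = 1 := by
      rw [← Units.val_pow_eq_pow_val, hε, Units.val_one]
    have hY0 : (Y : ℂ) ≠ 0 := Y.ne_zero
    simp only [Units.val_mul, Units.val_inv_eq_inv_val, Units.val_pow_eq_pow_val]
    rw [mul_pow, this, mul_comm 2 n, pow_mul]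
    field_simp
  · obtain ⟨v, hv, Y, t, hY, ht⟩ := exists_common_eigenvector hcomm
    have hX := ((hY.mul ht).pow n).mul (hY.pow n).inv
    rw [← hSL, mul_pow, mul_comm (Y ^ n), mul_inv_cancel_right] at hX
    have hZ := ((hY.mul ht).pow n).mul (ht.pow n).inv
    rw [← hLL, mul_pow, mul_inv_cancel_right] at hZ
    refine ⟨v, hv, _, Y, hX, hY, Or.inr ⟨t, by simp, ?_⟩⟩
    set A := ρ (knotToGlued n meridian) with hA
    set B := ρ (knotToGlued n figEightY) with hB
    have hrel : A * figEightWord A B = figEightWord A B * B := by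
      have := congrArg (fun g => ρ (knotToGlued n g)) figEight_relation
      simpa [map_figEightWord] using this
    set W := figEightWord A B * figEightWordStar A B with hW
    have hlam : ρ (knotToGlued n longitude) = W := by
      rw [longitude_eq]
      simp [map_figEightWord, map_figEightWordStar, hA, hB, hW]
    have hl : A ^ 4 * W = ρ (linkToGlued n (linkL n)) := by
      rw [← glue_linkL]; simp [hlam, hA]
    have hm' : A ^ 3 * W = m := by
      rw [hm, ← glue_linkM]; simp [hlam, hA]
    have hAe : A = ρ (linkToGlued n (linkL n)) * m⁻¹ := by
      rw [← hl, ← hm']; group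
    have hWe : W = (A ^ 3)⁻¹ * m := by rw [← hm']; group
    -- The gluing is inverted: `μ = l * m⁻¹` and `λ = μ⁻³ * m`, where `l = a ^ n` because `a` and
    -- `m` commute.
    have hM : IsEigen v A (Y ^ n * t⁻¹) := hAe ▸ hZ.mul ht.inv
    have hLam : IsEigen v W (((Y ^ n * t⁻¹) ^ 3)⁻¹ * t) := hWe ▸ (hM.pow 3).inv.mul ht
    have htr := trace_longitude hrel
    rw [hLam.trace_eq hv, hM.trace_eq hv] at htr
    have hY0 : (Y : ℂ) ^ n ≠ 0 := pow_ne_zero _ Y.ne_zero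
    have ht0 : (t : ℂ) ≠ 0 := t.ne_zero
    simp only [Units.val_mul, Units.val_inv_eq_inv_val, Units.val_pow_eq_pow_val] at htr
    rw [mul_comm 3 n, pow_mul]
    set z := (Y : ℂ) ^ n
    rcases htr with h | h
    · left
      field_simp at h
      -- Trace `2` makes the eigenvalue `t ^ 4 / z ^ 3` of the longitude a double root `1`.
      have : ((t : ℂ) ^ 4 - z ^ 3) ^ 2 = 0 := by linear_combination h
      exact sub_eq_zero.1 (pow_eq_zero_iff two_ne_zero |>.1 this)
    · right
      field_simp at h
      unfold knotCurve
      linear_combination h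

/-! ### The plane curve that carries the boundary eigenvalues. -/

open MvPolynomial

/-- A nonzero polynomial in `X₀` and `X₁` has a nonzero multiple that is a polynomial in
`X₀ ^ n` and `X₁`. -/
theorem exists_multiple_in_powers {n : ℕ} (hn : 0 < n) {H : MvPolynomial (Fin 2) ℂ} (hH : H ≠ 0) :
    ∃ G : MvPolynomial (Fin 2) ℂ, G ≠ 0 ∧
      ∀ t y : ℂ, eval ![t, y] H = 0 → eval ![t ^ n, y] G = 0 := by
  set ψ : MvPolynomial (Fin 2) ℂ →+* MvPolynomial (Fin 2) ℂ :=
    eval₂Hom C ![X 0 ^ n, X 1] with hψ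
  have hX (i : Fin 2) : ψ.IsIntegralElem (X i) := by
    fin_cases i
    · refine ⟨Polynomial.X ^ n - Polynomial.C (X 0), Polynomial.monic_X_pow_sub_C _ hn.ne', ?_⟩
      simp [hψ]
    · convert ψ.isIntegralElem_map (x := X 1) using 1
      simp [hψ]
  have hint (p) : ψ.IsIntegralElem p := by
    induction p using MvPolynomial.induction_on with
    | C a =>
      convert ψ.isIntegralElem_map (x := C a) using 1
      simp [hψ]
    | add p q hp hq => exact hp.add ψ hq
    | mul_X p i hp => exact hp.mul ψ (hX i)
  obtain ⟨f, hf, hfH⟩ := hint H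
  -- `ℂ[X₀, X₁]` is integral over `ℂ[X₀ ^ n, X₁]`, so the nonzero ideal `(H)` contracts to a nonzero
  -- ideal. This eliminates the `n`-th root `t` of `X`.
  have := Ideal.comap_ne_bot_of_root_mem hH (Ideal.mem_span_singleton_self H) hf.ne_zero hfH
  obtain ⟨G, hG, hG0⟩ := Submodule.exists_mem_ne_zero_of_ne_bot this
  refine ⟨G, hG0, fun t y h => ?_⟩
  obtain ⟨u, hu⟩ := Ideal.mem_span_singleton.1 (Ideal.mem_comap.1 hG)
  have h1 := congrArg (eval ![t, y]) hu
  rw [map_mul, h, zero_mul] at h1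
  rw [← h1]
  have : (eval ![t ^ n, y] : MvPolynomial (Fin 2) ℂ →+* ℂ) = (eval ![t, y]).comp ψ := by
    refine MvPolynomial.ringHom_ext (fun r => by simp [hψ]) fun i => ?_
    fin_cases i <;> simp [hψ]
  rw [this]
  rfl

/-- The restrictions of the representations of `Γ_n` to the boundary torus lie on a plane curve. -/
theorem exists_boundary_curve {n : ℕ} (hn : 0 < n) : ∃ Q : MvPolynomial (Fin 2) ℂ, Q ≠ 0 ∧
    ∀ χ : CharacterVariety (GluedGroup n), ∃ X Y : ℂˣ,
      torusQuotient X Y = restrict (gluedPeripheral n) χ ∧ eval ![(X : ℂ), (Y : ℂ)] Q = 0 := by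
  set H : MvPolynomial (Fin 2) ℂ :=
    (X 0 ^ 4 - X 1 ^ (3 * n)) * knotCurve (MvPolynomial (Fin 2) ℂ) (X 0) (X 1 ^ n) with hHdef
  have hH : H ≠ 0 := by
    refine mul_ne_zero (fun h => ?_) (fun h => ?_)
    · have := congrArg (eval ![(2 : ℂ), 1]) h
      simp at this
      norm_num at this
    · have := congrArg (eval ![(1 : ℂ), 1]) h
      simp [knotCurve] at this
      norm_num at this
  obtain ⟨G, hG, hGH⟩ := exists_multiple_in_powers hn hH
  refine ⟨(X 0 ^ 2 * X 1 ^ (2 * n) - 1) * G, mul_ne_zero (fun h => ?_) hG, fun χ => ?_⟩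
  · have := congrArg (eval ![(2 : ℂ), 1]) h
    simp at this
    norm_num at this
  obtain ⟨_, ρ, rfl⟩ := χ
  obtain ⟨v, hv, x, y, hx, hy, h⟩ := exists_eigenvalues ρ
  refine ⟨x, y, Subtype.ext (torusQuotient_eq_of_isEigen (ρ.comp (gluedPeripheral n)) hv ?_ ?_), ?_⟩
  · simpa [gluedPeripheral, torusHom_torusElt] using hx
  · simpa [gluedPeripheral, torusHom_torusElt] using hy
  · rw [map_mul, mul_eq_zero]
    rcases h with h | ⟨t, ht, h⟩
    · left
      simp [h]
    · right
      rw [← ht]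
      refine hGH t y ?_
      rw [hHdef, map_mul, mul_eq_zero]
      refine h.imp (fun h => ?_) (fun h => ?_)
      · simp [h]
      · simpa [knotCurve] using h

end

section

open CharacterVariety MvPolynomial

/-! ### The eigenvalue curve of the glued manifold -/

theorem exists_unit_point {Q : MvPolynomial (Fin 2) ℂ} (hQ : Q ≠ 0) :
    ∃ x y : ℂˣ, eval ![(x : ℂ), (y : ℂ)] Q ≠ 0 := by
  have h : Q * X 0 * X 1 ≠ 0 := mul_ne_zero (mul_ne_zero hQ (X_ne_zero 0)) (X_ne_zero 1)
  obtain ⟨v, hv⟩ : ∃ v : Fin 2 → ℂ, eval v (Q * X 0 * X 1) ≠ 0 := by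
    by_contra! hne
    exact h (MvPolynomial.funext fun v => by rw [hne v, map_zero])
  simp only [map_mul, eval_X, ne_eq, mul_eq_zero, not_or] at hv
  refine ⟨Units.mk0 _ hv.1.2, Units.mk0 _ hv.2, ?_⟩
  convert hv.1.1 using 3
  ext i
  fin_cases i <;> rfl

/-- The polynomial with the exponents reversed. -/
theorem exists_reverse {Q : MvPolynomial (Fin 2) ℂ} (hQ : Q ≠ 0) :
    ∃ R : MvPolynomial (Fin 2) ℂ, R ≠ 0 ∧ ∀ x y : ℂˣ,
      eval ![(x : ℂ), (y : ℂ)] R = 0 ↔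
        eval ![((x⁻¹ : ℂˣ) : ℂ), ((y⁻¹ : ℂˣ) : ℂ)] Q = 0 := by
  set N := Q.totalDegree with hN
  have hle (s) (hs : s ∈ Q.support) (i : Fin 2) : s i ≤ N := by
    refine le_trans ?_ (le_totalDegree hs)
    rw [Finsupp.sum_fintype _ _ (fun _ => rfl)]
    exact Finset.single_le_sum (f := fun i => s i) (fun _ _ => Nat.zero_le _) (Finset.mem_univ i)
  set R : MvPolynomial (Fin 2) ℂ :=
    ∑ s ∈ Q.support, C (Q.coeff s) * (X 0 ^ (N - s 0) * X 1 ^ (N - s 1)) with hR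
  have key (x y : ℂˣ) : eval ![(x : ℂ), (y : ℂ)] R =
      ((x : ℂ) * y) ^ N * eval ![((x⁻¹ : ℂˣ) : ℂ), ((y⁻¹ : ℂˣ) : ℂ)] Q := by
    rw [eval_eq' _ Q, hR, map_sum, Finset.mul_sum]
    refine Finset.sum_congr rfl fun s hs => ?_
    have hx : (x : ℂ) ≠ 0 := x.ne_zero
    have hy : (y : ℂ) ≠ 0 := y.ne_zero
    have h0 := pow_sub₀ _ hx (hle s hs 0)
    have h1 := pow_sub₀ _ hy (hle s hs 1)
    simp only [map_mul, eval_C, map_pow, eval_X, Fin.prod_univ_two, Matrix.cons_val_zero,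
      Matrix.cons_val_one, Units.val_inv_eq_inv_val, Matrix.cons_val_fin_one, h0, h1, inv_pow]
    ring
  have key' (x y : ℂˣ) : eval ![(x : ℂ), (y : ℂ)] R = 0 ↔
      eval ![((x⁻¹ : ℂˣ) : ℂ), ((y⁻¹ : ℂˣ) : ℂ)] Q = 0 := by
    rw [key, mul_eq_zero, or_iff_right (pow_ne_zero _ (mul_ne_zero x.ne_zero y.ne_zero))]
  refine ⟨R, ?_, key'⟩
  intro h0
  obtain ⟨x, y, hxy⟩ := exists_unit_point hQ
  refine hxy ?_
  have := (key' x⁻¹ y⁻¹).1 (by rw [h0, map_zero])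
  simpa using this

/-- A closed proper subset of `X(∂N_n)` contains the image of `X(N_n)`. -/
theorem exists_symmetric_boundary_curve {n : ℕ} (hn : 0 < n) :
    ∃ (p : MvPolynomial TorusGroup ℂ) (Q : MvPolynomial (Fin 2) ℂ), Q ≠ 0 ∧
      (zeros p ≠ Set.univ) ∧ (∀ χ, restrict (gluedPeripheral n) χ ∈ zeros p) ∧
      ∀ x y : ℂˣ, torusQuotient x y ∈ zeros p → eval ![(x : ℂ), (y : ℂ)] Q = 0 := by
  obtain ⟨Q, hQ, hcurve⟩ := exists_boundary_curve hn
  obtain ⟨R, hR, hQR⟩ := exists_reverse hQ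
  -- A character determines the eigenvalue pair only up to inversion, and only one of the two pairs
  -- is known to be a zero of `Q`. Multiplying by the inverted polynomial gives an equation on
  -- `X(∂N_n)`.
  obtain ⟨p, hp⟩ := exists_symm_mul Q
  have hpQ (x y : ℂˣ) : torusQuotient x y ∈ zeros p ↔ eval ![(x : ℂ), (y : ℂ)] (Q * R) = 0 := by
    rw [mem_zeros, hp, map_mul, mul_eq_zero, mul_eq_zero, hQR]
  refine ⟨p, Q * R, mul_ne_zero hQ hR, fun h => ?_, fun χ => ?_, fun x y => (hpQ x y).1⟩
  · obtain ⟨x, y, hxy⟩ := exists_unit_point (mul_ne_zero hQ hR)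
    exact hxy ((hpQ x y).1 (h ▸ Set.mem_univ _))
  · obtain ⟨x, y, hxy, h⟩ := hcurve χ
    rw [← hxy, hpQ, map_mul, h, zero_mul]

theorem vanishingIdeal_eigenvalueCurve_ne_bot {n : ℕ} (hn : 0 < n) :
    vanishingIdeal ℂ (eigenvalueCurve (gluedPeripheral n)) ≠ ⊥ := by
  obtain ⟨p, Q, hQ, -, hχ, hpQ⟩ := exists_symmetric_boundary_curve hn
  refine fun h => hQ ?_
  rw [← Ideal.mem_bot, ← h]
  rintro _ ⟨x, y, rfl, hxy⟩
  obtain ⟨X, -, χ, -, hχ'⟩ := Set.mem_iUnion₂.1 hxy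
  rw [aeval_eq_eval]
  exact hpQ x y (hχ' ▸ hχ χ)

theorem exists_isAPolynomial {n : ℕ} (hn : 0 < n) :
    ∃ A : MvPolynomial (Fin 2) ℤ, IsAPolynomial (gluedPeripheral n) A := by
  have h0 := vanishingIdeal_eigenvalueCurve_ne_bot hn
  obtain ⟨g, hg⟩ := exists_span_eq_vanishingIdeal h0 fun g v hv hgv =>
    eigenvalueCurve_infinite hv hgv
  exact exists_primitive_int_generator (fun v hv σ => twist_mem_eigenvalueCurve hv σ) h0 hg

/-- An irreducible family of characters of `Γ_n` that contains an irreducible character and is not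
constant on the boundary contributes to the curve `D`. -/
theorem image_subset_imageCurve {n : ℕ} (hn : 0 < n) {T : Set (CharacterVariety (GluedGroup n))}
    (hT : IsIrreducible T) (hirr : ∃ ρ : GluedGroup n →* SL2C, IsIrreducibleRep ρ ∧
      ∃ χ ∈ T, χ.1 = character ρ)
    (hnt : (restrict (gluedPeripheral n) '' T).Nontrivial) :
    restrict (gluedPeripheral n) '' T ⊆ imageCurve (gluedPeripheral n) := by
  obtain ⟨X, hX, hTX⟩ := exists_mem_irreducibleComponents_subset_of_isIrreducible T hT
  have hsub := Set.image_mono (f := restrict (gluedPeripheral n)) hTX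
  obtain ⟨p, Q, -, hp, hχ, -⟩ := exists_symmetric_boundary_curve hn
  -- Any component `X` containing `T` qualifies: its image lies in a proper closed set, hence has
  -- dimension at most one, and it has two points, hence dimension at least one.
  refine hsub.trans (Set.subset_biUnion_of_mem (u := fun X => restrict (gluedPeripheral n) '' X)
    (⟨hX, ?_, le_antisymm ?_ ?_⟩ : X ∈ curveComponents (gluedPeripheral n)))
  · obtain ⟨ρ, hρ, χ, hχ, h⟩ := hirr
    exact ⟨ρ, hρ, χ, hTX hχ, h⟩
  · refine topologicalKrullDim_le_one isClosed_closure fun h => hp ?_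
    refine Set.eq_univ_of_univ_subset (h ▸ closure_minimal ?_ (isClosed_zeros p))
    rintro _ ⟨χ, -, rfl⟩
    exact hχ χ
  · exact one_le_topologicalKrullDim
      (hX.1.image _ (continuous_restrict _).continuousOn).closure
      ((hnt.mono hsub).mono subset_closure)

end

/-! ### Representations of the glued group -/

section

variable {G : Type*} [Group G] {n : ℕ}

/-- The homomorphism from the figure-eight knot group given by images of the generators. -/
def figEightHom (A B : G) (h : A * figEightWord A B = figEightWord A B * B) : FigEightGroup →* G :=
  PresentedGroup.toGroup (f := fun g => FigEightGen.rec A B g) (by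
    rintro _ rfl
    simp only [map_mul, map_inv, map_figEightWord, FreeGroup.lift_apply_of]
    exact mul_inv_eq_one.2 h)

/-- The homomorphism from the torus link group given by images of the generators. -/
def torusLinkHom (a m : G) (h : a * (a * m) ^ n = (a * m) ^ n * a) : TorusLinkGroup n →* G :=
  PresentedGroup.toGroup (f := fun g => TorusLinkGen.rec a m g) (by
    rintro _ rfl
    simp only [map_mul, map_inv, map_pow, FreeGroup.lift_apply_of]
    exact mul_inv_eq_one.2 h)

theorem exists_gluedHom {A B a m : G} (h1 : A * figEightWord A B = figEightWord A B * B)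
    (h2 : a * (a * m) ^ n = (a * m) ^ n * a)
    (h3 : A ^ 4 * (figEightWord A B * figEightWordStar A B) = (a * m) ^ n * (m ^ n)⁻¹)
    (h4 : A ^ 3 * (figEightWord A B * figEightWordStar A B) = m) :
    ∃ ρ : GluedGroup n →* G, ρ (knotToGlued n meridian) = A ∧ ρ (knotToGlued n figEightY) = B ∧
      ρ (linkToGlued n (linkA n)) = a ∧ ρ (linkToGlued n (linkM n)) = m := by
  have hA : figEightHom A B h1 meridian = A := PresentedGroup.toGroup.of _
  have hB : figEightHom A B h1 figEightY = B := PresentedGroup.toGroup.of _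
  have ha : torusLinkHom a m h2 (linkA n) = a := PresentedGroup.toGroup.of _
  have hm : torusLinkHom a m h2 (linkM n) = m := PresentedGroup.toGroup.of _
  set F : Monoid.Coprod FigEightGroup (TorusLinkGroup n) →* G :=
    Monoid.Coprod.lift (figEightHom A B h1) (torusLinkHom a m h2) with hF
  have hle : Subgroup.normalClosure (gluingRelators n) ≤ F.ker := by
    refine Subgroup.normalClosure_le_normal ?_
    have hlam : figEightHom A B h1 longitude = figEightWord A B * figEightWordStar A B := by
      rw [longitude_eq, map_mul, map_figEightWord, map_figEightWordStar, hA, hB]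
    rintro _ (rfl | rfl)
    · rw [SetLike.mem_coe, MonoidHom.mem_ker, map_mul, map_inv, mul_inv_eq_one, hF,
        Monoid.Coprod.lift_apply_inl, Monoid.Coprod.lift_apply_inr, map_mul, map_pow, hA, hlam, h3]
      simp only [linkL, map_mul, map_inv, map_pow, ha, hm]
    · rw [SetLike.mem_coe, MonoidHom.mem_ker, map_mul, map_inv, mul_inv_eq_one, hF,
        Monoid.Coprod.lift_apply_inl, Monoid.Coprod.lift_apply_inr, map_mul, map_pow, hA, hlam, h4,
        hm]
  refine ⟨QuotientGroup.lift _ F hle, ?_, ?_, ?_, ?_⟩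
  · rw [← hA]; rfl
  · rw [← hB]; rfl
  · rw [← ha]; rfl
  · rw [← hm]; rfl

/-- A subgroup of `Γ_n` that contains the four generators is everything. -/
theorem gluedGroup_subgroup_eq_top {H : Subgroup (GluedGroup n)}
    (hA : knotToGlued n meridian ∈ H) (hB : knotToGlued n figEightY ∈ H)
    (ha : linkToGlued n (linkA n) ∈ H) (hm : linkToGlued n (linkM n) ∈ H) : H = ⊤ := by
  have h1 : H.comap (knotToGlued n) = ⊤ := by
    rw [eq_top_iff, ← PresentedGroup.closure_range_of, Subgroup.closure_le]
    rintro _ ⟨g, rfl⟩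
    cases g
    · exact hA
    · exact hB
  have h2 : H.comap (linkToGlued n) = ⊤ := by
    rw [eq_top_iff, ← PresentedGroup.closure_range_of, Subgroup.closure_le]
    rintro _ ⟨g, rfl⟩
    cases g
    · exact ha
    · exact hm
  rw [eq_top_iff]
  rintro g -
  obtain ⟨g, rfl⟩ := QuotientGroup.mk'_surjective _ g
  induction g using Monoid.Coprod.induction_on with
  | inl x => exact (h1 ▸ Subgroup.mem_top x : x ∈ H.comap (knotToGlued n))
  | inr x => exact (h2 ▸ Subgroup.mem_top x : x ∈ H.comap (linkToGlued n))
  | mul x y hx hy => exact H.mul_mem hx hy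

end

/-- The elements whose matrix entries are analytic in the parameter form a subgroup, because
inversion in `SL₂` is polynomial in the entries. So the four generators suffice. -/
theorem analyticOnNhd_character {n : ℕ} {U : Set ℂ} (ρ : ℂ → GluedGroup n →* SL2C)
    (h : ∀ g ∈ [knotToGlued n meridian, knotToGlued n figEightY, linkToGlued n (linkA n),
      linkToGlued n (linkM n)], ∀ i j, AnalyticOnNhd ℂ (fun u => (ρ u g).1 i j) U)
    (g : GluedGroup n) : AnalyticOnNhd ℂ (fun u => character (ρ u) g) U := by
  let H : Subgroup (GluedGroup n) :=
    { carrier := {g | ∀ i j, AnalyticOnNhd ℂ (fun u => (ρ u g).1 i j) U}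
      mul_mem' := fun {a b} ha hb i j => by
        have := ((ha i 0).mul (hb 0 j)).add ((ha i 1).mul (hb 1 j))
        simpa only [map_mul, Matrix.SpecialLinearGroup.coe_mul, Matrix.mul_apply,
          Fin.sum_univ_two] using! this
      one_mem' := fun i j => by
        simpa using! analyticOnNhd_const
      inv_mem' := fun {a} ha i j => by
        have h (u : ℂ) : (ρ u a⁻¹).1 = !![(ρ u a).1 1 1, -(ρ u a).1 0 1; -(ρ u a).1 1 0,
            (ρ u a).1 0 0] := by
          rw [map_inv, Matrix.SpecialLinearGroup.coe_inv, Matrix.adjugate_fin_two]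
        simp only [h]
        fin_cases i <;> fin_cases j
        · exact ha 1 1
        · exact (ha 0 1).neg
        · exact (ha 1 0).neg
        · exact ha 0 0 }
  have hH : H = ⊤ := gluedGroup_subgroup_eq_top (h _ (by simp)) (h _ (by simp)) (h _ (by simp))
    (h _ (by simp))
  have hg : g ∈ H := hH ▸ Subgroup.mem_top g
  simp only [character, Matrix.trace_fin_two]
  exact (hg 0 0).add (hg 1 1)

/-- A representation is irreducible if it contains a diagonal matrix with distinct eigenvalues and
a matrix whose off-diagonal entries are nonzero. -/
theorem isIrreducibleRep_of_diag {Γ : Type*} [Group Γ] {ρ : Γ →* SL2C} {g h : Γ} {M : ℂˣ}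
    (hg : ρ g = diagSL M) (hM : (M : ℂ) ≠ ((M⁻¹ : ℂˣ) : ℂ)) (h01 : (ρ h).1 0 1 ≠ 0)
    (h10 : (ρ h).1 1 0 ≠ 0) : IsIrreducibleRep ρ := by
  intro W hW
  rw [or_iff_not_imp_left]
  intro hbot
  obtain ⟨v, hv, hv0⟩ := Submodule.exists_mem_ne_zero_of_ne_bot hbot
  have hsub : (M : ℂ) - ((M⁻¹ : ℂˣ) : ℂ) ≠ 0 := sub_ne_zero.2 hM
  have hd (v : Fin 2 → ℂ) : (ρ g).1.mulVec v = ![(M : ℂ) * v 0, ((M⁻¹ : ℂˣ) : ℂ) * v 1] := by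
    ext i
    fin_cases i <;> simp [hg, diagSL, Matrix.mulVec, dotProduct]
  have h0 (v) (hv : v ∈ W) (hv0 : v 0 ≠ 0) : ![1, 0] ∈ W := by
    have h1 := W.smul_mem ((((M : ℂ) - ((M⁻¹ : ℂˣ) : ℂ)) * v 0)⁻¹)
      (W.sub_mem (hW g v hv) (W.smul_mem ((M⁻¹ : ℂˣ) : ℂ) hv))
    convert h1 using 1
    rw [hd]
    ext i
    fin_cases i
    · simp only [Fin.zero_eta, Matrix.cons_val_zero, Pi.smul_apply, Pi.sub_apply, smul_eq_mul]
      rw [← sub_mul, inv_mul_cancel₀ (mul_ne_zero hsub hv0)]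
    · simp only [Fin.mk_one, Matrix.cons_val_one, Matrix.cons_val_fin_one, Pi.smul_apply,
        Pi.sub_apply, smul_eq_mul, sub_self, mul_zero]
  have h1 (v) (hv : v ∈ W) (hv0 : v 1 ≠ 0) : ![0, 1] ∈ W := by
    have h1 := W.smul_mem (((((M⁻¹ : ℂˣ) : ℂ) - (M : ℂ)) * v 1)⁻¹)
      (W.sub_mem (hW g v hv) (W.smul_mem (M : ℂ) hv))
    convert h1 using 1
    rw [hd]
    ext i
    fin_cases i
    · simp only [Fin.zero_eta, Matrix.cons_val_zero, Pi.smul_apply, Pi.sub_apply, smul_eq_mul,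
        sub_self, mul_zero]
    · simp only [Fin.mk_one, Matrix.cons_val_one, Matrix.cons_val_fin_one, Pi.smul_apply,
        Pi.sub_apply, smul_eq_mul]
      rw [← sub_mul, inv_mul_cancel₀ (mul_ne_zero (sub_ne_zero.2 hM.symm) hv0)]
  have hboth : ![1, 0] ∈ W ∧ ![0, 1] ∈ W := by
    by_cases hz : v 0 = 0
    · have hz1 : v 1 ≠ 0 := fun hz1 => hv0 (by ext i; fin_cases i <;> simpa)
      have he := h1 v hv hz1
      refine ⟨h0 _ (hW h _ he) ?_, he⟩
      simpa [Matrix.mulVec, dotProduct] using h01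
    · have he := h0 v hv hz
      refine ⟨he, h1 _ (hW h _ he) ?_⟩
      simpa [Matrix.mulVec, dotProduct] using h10
  rw [Submodule.eq_top_iff']
  intro w
  convert W.add_mem (W.smul_mem (w 0) hboth.1) (W.smul_mem (w 1) hboth.2) using 1
  ext i
  fin_cases i <;> simp

/-! ### Representations that are diagonal on the torus link group. -/

theorem diagSL_mul (x y : ℂˣ) : diagSL (x * y) = diagSL x * diagSL y := by
  apply Subtype.ext
  change _ = !![(x : ℂ), 0; 0, ((x⁻¹ : ℂˣ) : ℂ)] * !![(y : ℂ), 0; 0, ((y⁻¹ : ℂˣ) : ℂ)]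
  simp [diagSL, mul_comm]

/-- `diagSL` as a homomorphism. -/
def diagHom : ℂˣ →* SL2C := MonoidHom.mk' diagSL diagSL_mul

theorem diagSL_pow (x : ℂˣ) (k : ℕ) : diagSL (x ^ k) = diagSL x ^ k := map_pow diagHom x k

theorem diagSL_inv (x : ℂˣ) : diagSL x⁻¹ = (diagSL x)⁻¹ := map_inv diagHom x

/-- Representations of the glued group that are diagonal on the torus link group. -/
theorem exists_diagonal_rep {n : ℕ} {u δ : ℂ} {ℓ Y U : ℂˣ} (hu : (U : ℂ) = u) (hu1 : 1 - u ^ 2 ≠ 0)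
    (hδ : δ ^ 2 = (1 - 3 * u ^ 2 + u ^ 4) * (1 + u ^ 2 + u ^ 4))
    (hℓ : (1 - u ^ 2 - 2 * u ^ 4 - u ^ 6 + u ^ 8 + (1 - u ^ 4) * δ) * ℓ = 2) (hY : Y ^ n = ℓ) :
    ∃ ρ : GluedGroup n →* SL2C, ρ (knotToGlued n meridian) = diagSL U⁻¹ ∧
      (ρ (knotToGlued n figEightY)).1 = !![(1 + u ^ 2 - u ^ 4 + δ) / (2 * u * (1 - u ^ 2)), 1;
        (1 + u ^ 2 - u ^ 4 + δ) / (2 * u * (1 - u ^ 2)) *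
          ((1 - u ^ 2 - u ^ 4 - δ) / (2 * u * (1 - u ^ 2))) - 1,
        (1 - u ^ 2 - u ^ 4 - δ) / (2 * u * (1 - u ^ 2))] ∧
      ρ (linkToGlued n (linkA n)) = diagSL Y ∧ ρ (linkToGlued n (linkM n)) = diagSL (U * ℓ) := by
  have hu0 : u ≠ 0 := hu ▸ U.ne_zero
  set p := (1 + u ^ 2 - u ^ 4 + δ) / (2 * u * (1 - u ^ 2)) with hp
  set q := (1 - u ^ 2 - u ^ 4 - δ) / (2 * u * (1 - u ^ 2)) with hq
  -- The diagonal entries are determined by `tr B = x` and `tr (A * B⁻¹) = z`. The entry `1` is a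
  -- normalization by diagonal conjugation, and the determinant gives the last entry.
  let B : SL2C := ⟨!![p, 1; p * q - 1, q], by rw [Matrix.det_fin_two_of]; ring⟩
  set x := u⁻¹ + u with hx
  -- A root of the Riley polynomial. Its discriminant `(x ^ 2 - 1) * (x ^ 2 - 5)` equals `δ ^ 2 / u
  -- ^ 4`.
  set z := (1 + u ^ 2 + u ^ 4 - δ) / (2 * u ^ 2) with hz
  have hA : Matrix.trace (diagSL U⁻¹ : Matrix (Fin 2) (Fin 2) ℂ) = x := by
    simp [diagSL, Matrix.trace_fin_two, hu, hx]
  have hB : Matrix.trace (B : Matrix (Fin 2) (Fin 2) ℂ) = x := by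
    simp only [B, Matrix.trace_fin_two_of, hp, hq, hx]
    field_simp
    ring
  have hz' : Matrix.trace ((diagSL U⁻¹ * B⁻¹ : SL2C) : Matrix (Fin 2) (Fin 2) ℂ) = z := by
    have : ((diagSL U⁻¹ * B⁻¹ : SL2C) : Matrix (Fin 2) (Fin 2) ℂ) =
        !![u⁻¹, 0; 0, u] * !![q, -1; -(p * q - 1), p] := by
      rw [Matrix.SpecialLinearGroup.coe_mul, Matrix.SpecialLinearGroup.coe_inv]
      simp [B, Matrix.adjugate_fin_two, diagSL, hu]
    rw [this, Matrix.mul_fin_two, Matrix.trace_fin_two_of, hp, hq, hz]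
    field_simp
    ring
  have hR : z ^ 2 - (x ^ 2 - 1) * z + x ^ 2 - 1 = 0 := by
    rw [hz, hx]
    field_simp
    linear_combination hδ
  have h1 : diagSL U⁻¹ * figEightWord (diagSL U⁻¹) B = figEightWord (diagSL U⁻¹) B * B :=
    (figEight_relator_iff hA hB hz').2 (Or.inr hR)
  have hW : figEightWord (diagSL U⁻¹) B * figEightWordStar (diagSL U⁻¹) B = diagSL (U ^ 4 * ℓ) := by
    apply Subtype.ext
    have hℓ0 : (ℓ : ℂ) ≠ 0 := ℓ.ne_zero
    rw [coe_longitude hA hB hz' hR]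
    have hs : 2 * z - x ^ 2 + 1 = -δ / u ^ 2 := by
      rw [hz, hx]; field_simp; ring
    rw [hs]
    ext i j
    -- The expression in `hℓ` and its conjugate under `δ ↦ -δ` have product `4 * u ^ 8`. This is the
    -- determinant condition for the longitude, whose diagonal entries are these expressions divided
    -- by `2 * u ^ 4`.
    have hprod : (1 - u ^ 2 - 2 * u ^ 4 - u ^ 6 + u ^ 8 - (1 - u ^ 4) * δ) = 2 * u ^ 8 * ℓ := by
      linear_combination -(1 - u ^ 2 - 2 * u ^ 4 - u ^ 6 + u ^ 8 - (1 - u ^ 4) * δ) / 2 * hℓ -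
        (1 - u ^ 4) ^ 2 * ℓ / 2 * hδ
    fin_cases i <;> fin_cases j
    · simp [diagSL, hu, hx]
      field_simp
      linear_combination hprod
    · simp [diagSL]
    · simp [diagSL]
    · simp [diagSL, hu, hx]
      field_simp
      linear_combination hℓ
  have hcomm : Commute (diagSL Y) (diagSL (U * ℓ)) := diagSL_commute _ _
  obtain ⟨ρ, hρA, hρB, hρa, hρm⟩ := exists_gluedHom (n := n) (a := diagSL Y)
    (m := diagSL (U * ℓ)) h1 (((Commute.refl _).mul_right hcomm).pow_right n).eq
    (by
      rw [hW, hcomm.mul_pow, mul_inv_cancel_right, ← diagSL_pow, ← diagSL_pow, ← diagSL_mul, hY]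
      congr 1
      group)
    (by
      rw [hW, ← diagSL_pow, ← diagSL_mul]
      congr 1
      group)
  exact ⟨ρ, hρA, by rw [hρB], hρa, hρm⟩

section

open CharacterVariety MvPolynomial Filter Topology

/-! ### A branch of the eigenvalue curve -/

/-- A square root of the discriminant of the Riley polynomial near the ideal point. -/
def branchSqrt (u : ℂ) : ℂ := ((1 - 3 * u ^ 2 + u ^ 4) * (1 + u ^ 2 + u ^ 4)) ^ (1 / 2 : ℂ)

/-- The denominator of the branch of `μ⁴ λ`. -/
def branchDen (u : ℂ) : ℂ := 1 - u ^ 2 - 2 * u ^ 4 - u ^ 6 + u ^ 8 + (1 - u ^ 4) * branchSqrt u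

/-- The eigenvalue of `μ⁴ λ` as a function of the inverse of the eigenvalue of `μ`. -/
def branchZ (u : ℂ) : ℂ := 2 / branchDen u

/-- The eigenvalue of `a`. -/
def branchY (n : ℕ) (ω u : ℂ) : ℂ := ω * branchZ u ^ (1 / n : ℂ)

theorem branchSqrt_zero : branchSqrt 0 = 1 := by simp [branchSqrt]

theorem branchDen_zero : branchDen 0 = 2 := by
  simp [branchDen, branchSqrt_zero]
  norm_num

theorem branchZ_zero : branchZ 0 = 1 := by simp [branchZ, branchDen_zero]

theorem branchSqrt_sq (u : ℂ) :
    branchSqrt u ^ 2 = (1 - 3 * u ^ 2 + u ^ 4) * (1 + u ^ 2 + u ^ 4) := by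
  rw [branchSqrt, ← Complex.cpow_nat_mul]
  norm_num

theorem branchY_pow {n : ℕ} (hn : 0 < n) {ω : ℂ} (hω : ω ^ n = 1) (u : ℂ) :
    branchY n ω u ^ n = branchZ u := by
  have : (n : ℂ) ≠ 0 := by exact_mod_cast hn.ne'
  rw [branchY, mul_pow, hω, one_mul, ← Complex.cpow_nat_mul, mul_one_div_cancel this,
    Complex.cpow_one]

theorem branchY_zero (n : ℕ) (ω : ℂ) : branchY n ω 0 = ω := by simp [branchY, branchZ_zero]

/-- The conditions under which the branch is analytic and defines irreducible representations. -/
def BranchGood (u : ℂ) : Prop :=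
  (1 - 3 * u ^ 2 + u ^ 4) * (1 + u ^ 2 + u ^ 4) ∈ Complex.slitPlane ∧ branchDen u ≠ 0 ∧
    branchZ u ∈ Complex.slitPlane ∧ 1 - 3 * u ^ 2 + u ^ 4 ≠ 0 ∧ 1 - u ^ 2 ≠ 0

theorem analyticAt_branchSqrt {u : ℂ}
    (h : (1 - 3 * u ^ 2 + u ^ 4) * (1 + u ^ 2 + u ^ 4) ∈ Complex.slitPlane) :
    AnalyticAt ℂ branchSqrt u :=
  AnalyticAt.cpow (by fun_prop) analyticAt_const h

theorem analyticAt_branchDen {u : ℂ}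
    (h : (1 - 3 * u ^ 2 + u ^ 4) * (1 + u ^ 2 + u ^ 4) ∈ Complex.slitPlane) :
    AnalyticAt ℂ branchDen u :=
  AnalyticAt.add (by fun_prop) (AnalyticAt.mul (by fun_prop) (analyticAt_branchSqrt h))

theorem analyticAt_branchZ {u : ℂ}
    (h : (1 - 3 * u ^ 2 + u ^ 4) * (1 + u ^ 2 + u ^ 4) ∈ Complex.slitPlane)
    (h' : branchDen u ≠ 0) : AnalyticAt ℂ branchZ u :=
  AnalyticAt.div analyticAt_const (analyticAt_branchDen h) h'

theorem analyticAt_branchY (n : ℕ) (ω : ℂ) {u : ℂ} (h : BranchGood u) :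
    AnalyticAt ℂ (branchY n ω) u :=
  AnalyticAt.mul analyticAt_const
    (AnalyticAt.cpow (analyticAt_branchZ h.1 h.2.1) analyticAt_const h.2.2.1)

theorem branchGood_zero : BranchGood 0 := by
  refine ⟨?_, ?_, ?_, ?_, ?_⟩ <;> simp [branchDen_zero, branchZ_zero]

theorem eventually_branchGood : ∀ᶠ u in 𝓝 (0 : ℂ), BranchGood u := by
  have h := branchGood_zero
  have c1 : ContinuousAt (fun u : ℂ => (1 - 3 * u ^ 2 + u ^ 4) * (1 + u ^ 2 + u ^ 4)) 0 := by
    fun_prop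
  have c2 : ContinuousAt (fun u : ℂ => 1 - 3 * u ^ 2 + u ^ 4) 0 := by fun_prop
  have c3 : ContinuousAt (fun u : ℂ => 1 - u ^ 2) 0 := by fun_prop
  exact (c1.eventually_mem (Complex.isOpen_slitPlane.mem_nhds h.1)).and
    (((analyticAt_branchDen h.1).continuousAt.eventually_ne h.2.1).and
    (((analyticAt_branchZ h.1 h.2.1).continuousAt.eventually_mem
      (Complex.isOpen_slitPlane.mem_nhds h.2.2.1)).and
    ((c2.eventually_ne h.2.2.2.1).and (c3.eventually_ne h.2.2.2.2))))

/-- The off-diagonal entries of the second generator do not vanish along the branch. -/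
theorem offDiag_ne_zero {u δ : ℂ} (hu : u ≠ 0) (h1 : 1 - u ^ 2 ≠ 0)
    (h3 : 1 - 3 * u ^ 2 + u ^ 4 ≠ 0)
    (hδ : δ ^ 2 = (1 - 3 * u ^ 2 + u ^ 4) * (1 + u ^ 2 + u ^ 4)) :
    (1 + u ^ 2 - u ^ 4 + δ) / (2 * u * (1 - u ^ 2)) *
      ((1 - u ^ 2 - u ^ 4 - δ) / (2 * u * (1 - u ^ 2))) - 1 ≠ 0 := by
  intro h
  field_simp at h
  -- The numerator of the entry factors in `δ`. Substituting either value of `δ` into `hδ` forces `u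
  -- = 0`.
  have hprod : (δ - (1 - 3 * u ^ 2 + u ^ 4)) * (δ + (1 - u ^ 2 + u ^ 4)) = 0 := by
    linear_combination -h
  have hu2 : u ^ 2 ≠ 0 := pow_ne_zero 2 hu
  rcases mul_eq_zero.1 hprod with h | h
  · rw [sub_eq_zero.1 h, sq] at hδ
    have := mul_left_cancel₀ h3 hδ
    exact hu2 (by linear_combination -this / 4)
  · rw [eq_neg_of_add_eq_zero_left h] at hδ
    exact pow_ne_zero 4 hu (by linear_combination hδ / 4)

/-- The explicit diagonal representations form an analytic family of irreducible representations
that is not constant on the boundary, so its characters lie in components that count. The matrices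
have poles at `u = 0`; the disc with `0` on its boundary avoids them, is connected, and still allows
the limit `u → 0`. -/
theorem branch_mem_eigenvalueCurve {n : ℕ} (hn : 0 < n) {ω : ℂ} (hω : ω ^ n = 1) :
    ∃ r : ℝ, 0 < r ∧ ∀ u ∈ Metric.ball (r : ℂ) r,
      ![(u * branchZ u) ^ n, branchY n ω u] ∈ eigenvalueCurve (gluedPeripheral n) := by
  obtain ⟨R, hR, hgood⟩ := Metric.eventually_nhds_iff_ball.1 eventually_branchGood
  set r := R / 2 with hr
  have hr0 : 0 < r := by positivity
  set U := Metric.ball (r : ℂ) r with hU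
  have hUgood : ∀ u ∈ U, BranchGood u := fun u hu => hgood u (by
    rw [Metric.mem_ball] at hu ⊢
    calc dist u 0 ≤ dist u r + dist (r : ℂ) 0 := dist_triangle _ _ _
      _ < r + r := by
        refine add_lt_add_of_lt_of_le hu ?_
        simp [abs_of_pos hr0]
      _ = R := by rw [hr]; ring)
  have hU0 : ∀ u ∈ U, u ≠ 0 := by
    rintro _ hu rfl
    rw [Metric.mem_ball] at hu
    simp [abs_of_pos hr0] at hu
  have hUopen : IsOpen U := Metric.isOpen_ball
  have hUclosure : (0 : ℂ) ∈ closure U := by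
    rw [hU, closure_ball _ hr0.ne']
    simp [abs_of_pos hr0]
  have hZ0 : ∀ u ∈ U, branchZ u ≠ 0 := fun u hu => Complex.slitPlane_ne_zero (hUgood u hu).2.2.1
  have hY0 : ∀ u ∈ U, branchY n ω u ≠ 0 := fun u hu h => hZ0 u hu (by
    rw [← branchY_pow hn hω, h, zero_pow hn.ne'])
  have hex : ∀ u ∈ U, ∃ ρ : GluedGroup n →* SL2C,
      (ρ (knotToGlued n meridian)).1 = !![u⁻¹, 0; 0, u] ∧
      (ρ (knotToGlued n figEightY)).1 =
        !![(1 + u ^ 2 - u ^ 4 + branchSqrt u) / (2 * u * (1 - u ^ 2)), 1;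
        (1 + u ^ 2 - u ^ 4 + branchSqrt u) / (2 * u * (1 - u ^ 2)) *
          ((1 - u ^ 2 - u ^ 4 - branchSqrt u) / (2 * u * (1 - u ^ 2))) - 1,
        (1 - u ^ 2 - u ^ 4 - branchSqrt u) / (2 * u * (1 - u ^ 2))] ∧
      (ρ (linkToGlued n (linkA n))).1 = !![branchY n ω u, 0; 0, (branchY n ω u)⁻¹] ∧
      (ρ (linkToGlued n (linkM n))).1 = !![u * branchZ u, 0; 0, (u * branchZ u)⁻¹] := by
    intro u hu
    obtain ⟨ρ, h1, h2, h3, h4⟩ := exists_diagonal_rep (n := n) (u := u) (δ := branchSqrt u)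
      (U := Units.mk0 u (hU0 u hu)) (ℓ := Units.mk0 _ (hZ0 u hu)) (Y := Units.mk0 _ (hY0 u hu)) rfl
      (hUgood u hu).2.2.2.2 (branchSqrt_sq u)
      (by
        change branchDen u * branchZ u = 2
        rw [branchZ, mul_div_cancel₀ _ (hUgood u hu).2.1])
      (Units.ext (branchY_pow hn hω u))
    refine ⟨ρ, ?_, h2, ?_, ?_⟩
    · rw [h1]; simp [diagSL]
    · rw [h3]; simp [diagSL]
    · rw [h4]; simp [diagSL]
  choose! ρ hρA hρB hρa hρm using hex
  set χ : ℂ → CharacterVariety (GluedGroup n) := fun u => ⟨character (ρ u), ρ u, rfl⟩ with hχ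
  have hdiag : ∀ (g : GluedGroup n) (f : ℂ → ℂ), (∀ u ∈ U, AnalyticAt ℂ f u) → (∀ u ∈ U, f u ≠ 0) →
      (∀ u ∈ U, (ρ u g).1 = !![f u, 0; 0, (f u)⁻¹]) →
      ∀ i j, AnalyticOnNhd ℂ (fun u => (ρ u g).1 i j) U := by
    intro g f hf hf0 hg i j
    have : AnalyticOnNhd ℂ (fun u => (!![f u, 0; 0, (f u)⁻¹] : Matrix (Fin 2) (Fin 2) ℂ) i j) U := by
      fin_cases i <;> fin_cases j
      · exact hf
      · exact analyticOnNhd_const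
      · exact analyticOnNhd_const
      · exact fun u hu => (hf u hu).inv (hf0 u hu)
    exact this.congr hUopen fun u hu => by rw [hg u hu]
  have hAn : ∀ g, AnalyticOnNhd ℂ (fun u => (χ u).1 g) U := by
    refine analyticOnNhd_character ρ fun g hg => ?_
    simp only [List.mem_cons, List.not_mem_nil, or_false] at hg
    rcases hg with rfl | rfl | rfl | rfl
    · exact hdiag _ (fun u => u⁻¹) (fun u hu => analyticAt_id.inv (hU0 u hu))
        (fun u hu => inv_ne_zero (hU0 u hu)) (fun u hu => by rw [hρA u hu, inv_inv])
    · intro i j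
      have hden : ∀ u ∈ U, 2 * u * (1 - u ^ 2) ≠ 0 := fun u hu =>
        mul_ne_zero (mul_ne_zero two_ne_zero (hU0 u hu)) (hUgood u hu).2.2.2.2
      have hp : AnalyticOnNhd ℂ
          (fun u => (1 + u ^ 2 - u ^ 4 + branchSqrt u) / (2 * u * (1 - u ^ 2))) U := fun u hu =>
        AnalyticAt.div (AnalyticAt.add (by fun_prop) (analyticAt_branchSqrt (hUgood u hu).1))
          (by fun_prop) (hden u hu)
      have hq : AnalyticOnNhd ℂ
          (fun u => (1 - u ^ 2 - u ^ 4 - branchSqrt u) / (2 * u * (1 - u ^ 2))) U := fun u hu =>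
        AnalyticAt.div (AnalyticAt.sub (by fun_prop) (analyticAt_branchSqrt (hUgood u hu).1))
          (by fun_prop) (hden u hu)
      refine AnalyticOnNhd.congr (f := fun u =>
        (!![(1 + u ^ 2 - u ^ 4 + branchSqrt u) / (2 * u * (1 - u ^ 2)), 1;
          (1 + u ^ 2 - u ^ 4 + branchSqrt u) / (2 * u * (1 - u ^ 2)) *
            ((1 - u ^ 2 - u ^ 4 - branchSqrt u) / (2 * u * (1 - u ^ 2))) - 1,
          (1 - u ^ 2 - u ^ 4 - branchSqrt u) / (2 * u * (1 - u ^ 2))] :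
            Matrix (Fin 2) (Fin 2) ℂ) i j) hUopen ?_ fun u hu => by rw [hρB u hu]
      fin_cases i <;> fin_cases j
      · exact hp
      · exact analyticOnNhd_const
      · exact (hp.mul hq).sub analyticOnNhd_const
      · exact hq
    · exact hdiag _ _ (fun u hu => analyticAt_branchY n ω (hUgood u hu)) hY0 hρa
    · exact hdiag _ (fun u => u * branchZ u) (fun u hu => analyticAt_id.mul
        (analyticAt_branchZ (hUgood u hu).1 (hUgood u hu).2.1))
        (fun u hu => mul_ne_zero (hU0 u hu) (hZ0 u hu)) hρm
  have hbdry : ∀ u (hu : u ∈ U), restrict (gluedPeripheral n) (χ u) =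
      torusQuotient (Units.mk0 _ (pow_ne_zero n (mul_ne_zero (hU0 u hu) (hZ0 u hu))))
        (Units.mk0 _ (hY0 u hu)) := by
    intro u hu
    have ha : ρ u (linkToGlued n (linkA n)) = diagSL (Units.mk0 _ (hY0 u hu)) :=
      Subtype.ext (by rw [hρa u hu]; simp [diagSL])
    have hm : ρ u (linkToGlued n (linkM n)) =
        diagSL (Units.mk0 _ (mul_ne_zero (hU0 u hu) (hZ0 u hu))) :=
      Subtype.ext (by rw [hρm u hu]; simp [diagSL])
    refine Subtype.ext (torusQuotient_eq_of_isEigen ((ρ u).comp (gluedPeripheral n))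
      (v := ![1, 0]) (fun h => by simpa using congrFun h 0) ?_ ?_).symm
    · have hL : ρ u (linkToGlued n (linkScriptL n)) = diagSL
          (Units.mk0 _ (pow_ne_zero n (mul_ne_zero (hU0 u hu) (hZ0 u hu)))) := by
        simp only [linkScriptL, map_mul, map_pow, map_inv, ha, hm]
        rw [← diagSL_mul, ← diagSL_pow, ← diagSL_pow, ← diagSL_inv, ← diagSL_mul, mul_pow,
          mul_comm (Units.mk0 (branchY n ω u) _ ^ n), mul_inv_cancel_right]
        congr 1
        ext
        simp
      simpa [gluedPeripheral, torusHom_torusElt, hL] using isEigen_diagSL _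
    · simpa [gluedPeripheral, torusHom_torusElt, ha] using isEigen_diagSL _
  have hUne : U.Nonempty := ⟨r, Metric.mem_ball_self hr0⟩
  have hT : IsIrreducible (χ '' U) := ⟨hUne.image _,
    isPreirreducible_image_of_analytic (convex_ball _ _).isPreconnected χ hAn⟩
  have hsub := image_subset_imageCurve hn hT ?_ ?_
  · refine ⟨r, hr0, fun u hu => ⟨_, _, rfl, hsub ⟨χ u, ⟨u, hu, rfl⟩, hbdry u hu⟩⟩⟩
  · obtain ⟨u, hu⟩ := hUne
    refine ⟨ρ u, isIrreducibleRep_of_diag (g := knotToGlued n meridian)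
      (h := knotToGlued n figEightY) (M := (Units.mk0 u (hU0 u hu))⁻¹) (Subtype.ext ?_) ?_ ?_ ?_,
      χ u, ⟨u, hu, rfl⟩, rfl⟩
    · rw [hρA u hu]
      simp [diagSL]
    · have := (hUgood u hu).2.2.2.2
      have h0 := hU0 u hu
      simp only [inv_inv, Units.val_inv_eq_inv_val, Units.val_mk0]
      intro h
      field_simp at h
      exact this (by rw [← h]; ring)
    · rw [hρB u hu]; simp
    · rw [hρB u hu]
      exact offDiag_ne_zero (hU0 u hu) (hUgood u hu).2.2.2.2 (hUgood u hu).2.2.2.1 (branchSqrt_sq u)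
  -- If the boundary character were constant, so would be the trace `c` of `𝓛`. Then `X ^ 2 - c * X
  -- + 1 = 0` along the branch, and the limit `X → 0` gives `1 = 0`.
  · by_contra hnt
    rw [Set.not_nontrivial_iff] at hnt
    obtain ⟨u₀, hu₀⟩ := hUne
    set c := (restrict (gluedPeripheral n) (χ u₀)).1 (torusElt 1 0)
    have hc : ∀ u ∈ U, ((u * branchZ u) ^ n) ^ 2 - c * (u * branchZ u) ^ n + 1 = 0 := by
      intro u hu
      have h1 : restrict (gluedPeripheral n) (χ u) = restrict (gluedPeripheral n) (χ u₀) :=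
        hnt ⟨_, ⟨u, hu, rfl⟩, rfl⟩ ⟨_, ⟨u₀, hu₀, rfl⟩, rfl⟩
      have h2 : c = (restrict (gluedPeripheral n) (χ u)).1 (torusElt 1 0) := by rw [h1]
      rw [hbdry u hu, torusQuotient_torusElt] at h2
      have h0 := pow_ne_zero n (mul_ne_zero (hU0 u hu) (hZ0 u hu))
      simp only [zpow_one, zpow_zero, mul_one, Units.val_inv_eq_inv_val, Units.val_mk0] at h2
      rw [h2]
      field_simp
      ring
    have hcont : ContinuousAt (fun u => ((u * branchZ u) ^ n) ^ 2 - c * (u * branchZ u) ^ n + 1)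
        0 := by
      have := (analyticAt_branchZ branchGood_zero.1 branchGood_zero.2.1).continuousAt
      fun_prop
    have : (𝓝[U] (0 : ℂ)).NeBot := mem_closure_iff_nhdsWithin_neBot.1 hUclosure
    have hlim := tendsto_nhds_unique (hcont.tendsto.mono_left nhdsWithin_le_nhds)
      (tendsto_const_nhds.congr' (eventually_nhdsWithin_of_forall fun u hu => (hc u hu).symm))
    simp [hn.ne'] at hlim

/-- At `X = 0` the A-polynomial vanishes at the `n`-th roots of unity. -/
theorem eval_zero_root_eq_zero {n : ℕ} (hn : 0 < n) {ω : ℂ} (hω : ω ^ n = 1)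
    {g : MvPolynomial (Fin 2) ℂ}
    (hg : g ∈ vanishingIdeal ℂ (eigenvalueCurve (gluedPeripheral n))) :
    eval ![0, ω] g = 0 := by
  obtain ⟨r, hr0, h⟩ := branch_mem_eigenvalueCurve hn hω
  have hcl : (0 : ℂ) ∈ closure (Metric.ball (r : ℂ) r) := by
    rw [closure_ball _ hr0.ne']
    simp [abs_of_pos hr0]
  have hcont : ContinuousAt (fun u => eval ![(u * branchZ u) ^ n, branchY n ω u] g) 0 := by
    have hZ := (analyticAt_branchZ branchGood_zero.1 branchGood_zero.2.1).continuousAt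
    have hY := (analyticAt_branchY n ω branchGood_zero).continuousAt
    have hv : ContinuousAt (fun u => (![(u * branchZ u) ^ n, branchY n ω u] : Fin 2 → ℂ)) 0 := by
      refine continuousAt_pi.2 fun i => ?_
      fin_cases i
      · exact (continuousAt_id.mul hZ).pow n
      · exact hY
    exact ContinuousAt.comp (g := fun v : Fin 2 → ℂ => eval v g)
      (MvPolynomial.continuous_eval g).continuousAt hv
  have : (𝓝[Metric.ball (r : ℂ) r] (0 : ℂ)).NeBot := mem_closure_iff_nhdsWithin_neBot.1 hcl
  have hlim := tendsto_nhds_unique (hcont.tendsto.mono_left nhdsWithin_le_nhds)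
    (tendsto_const_nhds.congr' (eventually_nhdsWithin_of_forall fun u hu => (hg _ (h u hu)).symm))
  rw [zero_mul, zero_pow hn.ne', branchY_zero] at hlim
  exact hlim

end

section

open Polynomial

/-! ### The left edge of a Newton polygon -/

theorem one_sub_X_pow_dvd_of_laurent {n : ℕ} (hn : 0 < n) {f : ℤ[X]}
    (h : (1 - LaurentPolynomial.T n : LaurentPolynomial ℤ) ∣ toLaurent f) : 1 - X ^ n ∣ f := by
  obtain ⟨g, hg⟩ := h
  obtain ⟨k, g', hg'⟩ := g.exists_T_pow
  have hdvd : 1 - X ^ n ∣ f * X ^ k := by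
    refine ⟨g', toLaurent_injective ?_⟩
    simp only [map_mul, map_sub, map_one, toLaurent_X_pow, hg, hg']
    ring
  have hcop : IsCoprime (1 - X ^ n : ℤ[X]) X :=
    ⟨1, X ^ (n - 1), by rw [← pow_succ, Nat.sub_add_cancel hn]; ring⟩
  exact hcop.pow_right.dvd_of_dvd_mul_right hdvd

/-- The `n`-th roots of unity are distinct, so vanishing at each of them gives divisibility over
`ℂ`. It descends to `ℤ` because `X ^ n - 1` is monic. -/
theorem one_sub_X_pow_dvd_of_roots {n : ℕ} (hn : 0 < n) {f : ℤ[X]}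
    (h : ∀ ω : ℂ, ω ^ n = 1 → (f.map (Int.castRingHom ℂ)).eval ω = 0) : 1 - X ^ n ∣ f := by
  have : NeZero n := ⟨hn.ne'⟩
  have hC : (X ^ n - 1 : ℂ[X]) ∣ f.map (Int.castRingHom ℂ) := by
    rw [X_pow_sub_one_eq_prod hn (Complex.isPrimitiveRoot_exp n hn.ne')]
    refine Finset.prod_dvd_of_coprime (fun x _ y _ hxy =>
      pairwise_coprime_X_sub_C Function.injective_id hxy) fun ω hω => ?_
    exact dvd_iff_isRoot.2 (h ω ((mem_nthRootsFinset hn _).1 hω))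
  rw [← neg_dvd, neg_sub, ← map_dvd_map (Int.castRingHom ℂ) Int.cast_injective
    (by simpa using monic_X_pow_sub_C (1 : ℤ) hn.ne')]
  simpa using hC

/-- The polynomial `A(0, Y)`. -/
def leftPoly (A : MvPolynomial (Fin 2) ℤ) : ℤ[X] := MvPolynomial.aeval ![0, X] A

theorem leftPoly_eq_sum (A : MvPolynomial (Fin 2) ℤ) :
    leftPoly A = ∑ s ∈ A.support with s 0 = 0, C (A.coeff s) * X ^ s 1 := by
  rw [leftPoly, MvPolynomial.aeval_def, MvPolynomial.eval₂_eq', Finset.sum_filter]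
  refine Finset.sum_congr rfl fun s _ => ?_
  by_cases h : s 0 = 0 <;> simp [h]

theorem toLaurent_leftPoly (A : MvPolynomial (Fin 2) ℤ) :
    toLaurent (leftPoly A) = ∑ s ∈ A.support with s 0 = 0,
      LaurentPolynomial.C (A.coeff s) * LaurentPolynomial.T (s 1 : ℤ) := by
  simp [leftPoly_eq_sum]

theorem eval_map_leftPoly (A : MvPolynomial (Fin 2) ℤ) (ω : ℂ) :
    ((leftPoly A).map (Int.castRingHom ℂ)).eval ω =
      MvPolynomial.eval ![0, ω] (MvPolynomial.map (Int.castRingHom ℂ) A) := by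
  rw [MvPolynomial.eval_map, MvPolynomial.eval₂_eq', leftPoly_eq_sum, Finset.sum_filter,
    Polynomial.map_sum, eval_finsetSum]
  refine Finset.sum_congr rfl fun s _ => ?_
  by_cases h : s 0 = 0 <;> simp [h]

theorem finsupp_fin_two_ext {s t : Fin 2 →₀ ℕ} (h0 : s 0 = t 0) (h1 : s 1 = t 1) : s = t := by
  ext i
  fin_cases i
  · exact h0
  · exact h1

theorem leftPoly_ne_zero {A : MvPolynomial (Fin 2) ℤ} {s : Fin 2 →₀ ℕ} (hs : s ∈ A.support)
    (h0 : s 0 = 0) : leftPoly A ≠ 0 := by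
  intro h
  have hc : (leftPoly A).coeff (s 1) = A.coeff s := by
    rw [leftPoly_eq_sum, finsetSum_coeff, Finset.sum_eq_single s]
    · simp
    · intro t ht hts
      rw [coeff_C_mul_X_pow, if_neg]
      exact fun h1 => hts (finsupp_fin_two_ext ((Finset.mem_filter.1 ht).2.trans h0.symm) h1.symm)
    · intro h'
      exact absurd (Finset.mem_filter.2 ⟨hs, h0⟩) h'
  rw [h, coeff_zero] at hc
  exact MvPolynomial.mem_support_iff.1 hs hc.symm

/-- The face of the Newton polygon on the second coordinate axis. -/
def leftFace (A : MvPolynomial (Fin 2) ℤ) : Set (ℝ × ℝ) := {x ∈ newtonPolygon A | x.1 = 0}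

theorem fst_nonneg_of_mem_newtonPolygon {A : MvPolynomial (Fin 2) ℤ} {x : ℝ × ℝ}
    (hx : x ∈ newtonPolygon A) : 0 ≤ x.1 := by
  refine convexHull_min (t := {x : ℝ × ℝ | 0 ≤ x.1}) ?_ ?_ hx
  · rintro _ ⟨s, _, rfl⟩
    exact Nat.cast_nonneg (α := ℝ) (s 0)
  · exact (convex_Ici (0 : ℝ)).linear_preimage (LinearMap.fst ℝ ℝ ℝ)

theorem exponentPoint_mem_leftFace {A : MvPolynomial (Fin 2) ℤ} {s : Fin 2 →₀ ℕ}
    (hs : s ∈ A.support) : exponentPoint s ∈ leftFace A ↔ s 0 = 0 := by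
  have : exponentPoint s ∈ newtonPolygon A := subset_convexHull ℝ _ ⟨s, hs, rfl⟩
  exact ⟨fun h => Nat.cast_eq_zero.1 h.2, fun h => ⟨this, Nat.cast_eq_zero.2 h⟩⟩

open Classical in
theorem filter_leftFace (A : MvPolynomial (Fin 2) ℤ) :
    (A.support.filter fun s => exponentPoint s ∈ leftFace A) = A.support.filter fun s => s 0 = 0 :=
  Finset.filter_congr fun _ hs => exponentPoint_mem_leftFace hs

theorem isEdge_leftFace {A : MvPolynomial (Fin 2) ℤ} {x y : ℝ × ℝ} (hx : x ∈ leftFace A)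
    (hy : y ∈ leftFace A) (hxy : x.2 ≠ y.2) : IsEdge (newtonPolygon A) (leftFace A) := by
  constructor
  · refine fun _ => ⟨-ContinuousLinearMap.fst ℝ ℝ ℝ, Set.ext fun z => ?_⟩
    simp only [leftFace, Set.mem_ofPred_eq, neg_apply,
      ContinuousLinearMap.coe_fst', neg_le_neg_iff]
    refine and_congr_right fun hz => ⟨fun h w hw => ?_, fun h => ?_⟩
    · rw [h]
      exact fst_nonneg_of_mem_newtonPolygon hw
    · exact le_antisymm (hx.2 ▸ h x hx.1) (fst_nonneg_of_mem_newtonPolygon hz)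
  · have hspan : vectorSpan ℝ (leftFace A) = Submodule.span ℝ {((0, 1) : ℝ × ℝ)} := by
      apply le_antisymm
      · rw [vectorSpan_def, Submodule.span_le]
        rintro _ ⟨z, hz, w, hw, rfl⟩
        refine Submodule.mem_span_singleton.2 ⟨z.2 - w.2, Prod.ext ?_ ?_⟩
        · simp [hz.2, hw.2]
        · simp
      · rw [Submodule.span_le, Set.singleton_subset_iff]
        have := (vectorSpan ℝ (leftFace A)).smul_mem (x.2 - y.2)⁻¹
          (vsub_mem_vectorSpan ℝ hx hy)
        convert (show _ ∈ (vectorSpan ℝ (leftFace A) : Set (ℝ × ℝ)) from this) using 1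
        refine Prod.ext ?_ ?_
        · simp [hx.2, hy.2]
        · simp [inv_mul_cancel₀ (sub_ne_zero.2 hxy)]
    rw [hspan, finrank_span_singleton (by simp)]

theorem exists_isEdgePolynomial_leftFace {A : MvPolynomial (Fin 2) ℤ} (h : leftPoly A ≠ 0) :
    ∃ f, IsEdgePolynomial A (leftFace A) f := by
  obtain ⟨f, hf, hdvd⟩ := exists_eq_pow_rootMultiplicity_mul_and_not_dvd _ h 0
  rw [C_0, sub_zero] at hf hdvd
  -- With slope `1 / 0` and `a = 0`, `b = 1`, the edge polynomial is `A(0, Y)` with the largest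
  -- power of `Y` removed.
  refine ⟨f, 1, 0, 0, 1, by norm_num, ⟨0, fun x hx => ?_, ?_⟩, mt X_dvd_iff.2 hdvd,
    rootMultiplicity 0 (leftPoly A), ?_⟩
  · simpa using fst_nonneg_of_mem_newtonPolygon hx
  · simp [leftFace]
  · classical
    rw [← toLaurent_X_pow, ← map_mul, ← hf, toLaurent_leftPoly, filter_leftFace]
    simp

theorem one_sub_X_pow_dvd_of_isEdgePolynomial {n : ℕ} (hn : 0 < n) {A : MvPolynomial (Fin 2) ℤ}
    {x y : ℝ × ℝ} (hx : x ∈ leftFace A) (hy : y ∈ leftFace A) (hxy : x.2 ≠ y.2)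
    (hA : 1 - X ^ n ∣ leftPoly A) {f : ℤ[X]} (hf : IsEdgePolynomial A (leftFace A) f) :
    1 - X ^ n ∣ f := by
  classical
  obtain ⟨p, q, a, b, hdet, ⟨c, -, he⟩, -, m, hsum⟩ := hf
  have hx' : (p : ℝ) * x.1 - q * x.2 = c := (he.subset hx).2
  have hy' : (p : ℝ) * y.1 - q * y.2 = c := (he.subset hy).2
  rw [hx.2] at hx'
  rw [hy.2] at hy'
  have hq : q = 0 := by
    have : (q : ℝ) * (x.2 - y.2) = 0 := by linear_combination hy' - hx'
    exact_mod_cast (mul_eq_zero.1 this).resolve_right (sub_ne_zero.2 hxy)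
  rw [hq, mul_zero, sub_zero] at hdet
  have hdvd : (1 - LaurentPolynomial.T n : LaurentPolynomial ℤ) ∣ toLaurent (leftPoly A) := by
    simpa using map_dvd toLaurent hA
  apply one_sub_X_pow_dvd_of_laurent hn
  rw [← (LaurentPolynomial.isUnit_T m).dvd_mul_left, hsum]
  have hfilter : (∑ s ∈ A.support.filter (fun s => exponentPoint s ∈ leftFace A),
      LaurentPolynomial.C (A.coeff s) * LaurentPolynomial.T (b * (s 1 : ℤ) - a * (s 0 : ℤ))) =
      ∑ s ∈ A.support with s 0 = 0,
        LaurentPolynomial.C (A.coeff s) * LaurentPolynomial.T (b * (s 1 : ℤ)) := by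
    rw [filter_leftFace]
    exact Finset.sum_congr rfl fun s hs => by simp [(Finset.mem_filter.1 hs).2]
  rw [hfilter]
  -- On a vertical edge `q = 0` and `p * b = 1`, so only the sign of `b` is left. The sign `-1`
  -- inverts the variable, which changes `1 - T ^ n` only by a unit.
  rcases Int.eq_one_or_neg_one_of_mul_eq_one (mul_comm p b ▸ hdet) with rfl | rfl
  · simpa [toLaurent_leftPoly] using hdvd
  · have h := map_dvd (LaurentPolynomial.invert (R := ℤ)) hdvd
    rw [toLaurent_leftPoly] at h
    simp only [map_sub, map_one, map_sum, map_mul, LaurentPolynomial.invert_T,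
      LaurentPolynomial.invert_C] at h
    simp only [neg_one_mul]
    refine dvd_trans ⟨-LaurentPolynomial.T (-n), ?_⟩ h
    rw [mul_neg, sub_mul, one_mul, ← LaurentPolynomial.T_add, add_neg_cancel,
      LaurentPolynomial.T_zero, neg_sub]

/-! ### The vertical edge of the A-polynomial of `N_n`. -/

/-- The A-polynomial is not divisible by its first variable. -/
theorem exists_mem_support_of_isAPolynomial {n : ℕ} (hn : 0 < n) {A : MvPolynomial (Fin 2) ℤ}
    (hA : IsAPolynomial (gluedPeripheral n) A) : ∃ s ∈ A.support, s 0 = 0 := by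
  by_contra! h
  set P := MvPolynomial.map (Int.castRingHom ℂ) A with hP
  have hP0 : P ≠ 0 := by
    intro h0
    apply vanishingIdeal_eigenvalueCurve_ne_bot hn
    rw [← hA.1, ← hP, h0, Ideal.span_singleton_eq_bot]
  have hX : (MvPolynomial.X 0 : MvPolynomial (Fin 2) ℂ) ∣ P := by
    rw [P.as_sum]
    refine Finset.dvd_sum fun s hs => MvPolynomial.X_dvd_monomial.2 (Or.inr ?_)
    exact h s (MvPolynomial.support_map_subset _ _ hs)
  obtain ⟨B, hB⟩ := hX
  have hBmem : B ∈ MvPolynomial.vanishingIdeal ℂ (eigenvalueCurve (gluedPeripheral n)) := by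
    intro v hv
    have hPv : MvPolynomial.eval v P = 0 := by
      have : P ∈ MvPolynomial.vanishingIdeal ℂ (eigenvalueCurve (gluedPeripheral n)) :=
        hA.1 ▸ Ideal.mem_span_singleton_self _
      exact this v hv
    obtain ⟨L, M, rfl, -⟩ := hv
    rw [hB, map_mul, MvPolynomial.eval_X, mul_eq_zero] at hPv
    exact hPv.resolve_left L.ne_zero
  rw [← hA.1, Ideal.mem_span_singleton] at hBmem
  obtain ⟨Q, hQ⟩ := hBmem
  have hunit : (MvPolynomial.X 0 : MvPolynomial (Fin 2) ℂ) * Q = 1 := by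
    apply mul_left_cancel₀ hP0
    rw [← hP] at hQ
    rw [mul_one, mul_left_comm, ← hQ, ← hB]
  have := congrArg (MvPolynomial.eval 0) hunit
  simp at this

/-- The edge is the face on the axis `X = 0`. Its polynomial is `A(0, Y)` up to a power of `Y` and
inversion of `Y`, and `A(0, Y)` vanishes at all `n`-th roots of unity. -/
theorem exists_vertical_edge {n : ℕ} (hn : 0 < n) {A : MvPolynomial (Fin 2) ℤ}
    (hA : IsAPolynomial (gluedPeripheral n) A) :
    ∃ e : Set (ℝ × ℝ), IsEdge (newtonPolygon A) e ∧ IsVertical e ∧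
      (∃ f, IsEdgePolynomial A e f) ∧ ∀ f, IsEdgePolynomial A e f → 1 - X ^ n ∣ f := by
  obtain ⟨s, hs, hs0⟩ := exists_mem_support_of_isAPolynomial hn hA
  have hdvd : 1 - X ^ n ∣ leftPoly A := by
    refine one_sub_X_pow_dvd_of_roots hn fun ω hω => ?_
    rw [eval_map_leftPoly]
    exact eval_zero_root_eq_zero hn hω (hA.1 ▸ Ideal.mem_span_singleton_self _)
  obtain ⟨t, ht, ht0, hst⟩ : ∃ t ∈ A.support, t 0 = 0 ∧ s 1 ≠ t 1 := by
    by_contra! h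
    have hfilter : (A.support.filter fun t => t 0 = 0) = {s} := by
      refine Finset.eq_singleton_iff_unique_mem.2 ⟨Finset.mem_filter.2 ⟨hs, hs0⟩, fun t ht => ?_⟩
      obtain ⟨ht, ht0⟩ := Finset.mem_filter.1 ht
      exact finsupp_fin_two_ext (ht0.trans hs0.symm) (h t ht ht0).symm
    -- A single monomial takes its nonzero coefficient as value at `1`, where `1 - X ^ n` vanishes.
    -- So the face has two lattice points.
    have h1 := eval_dvd (x := 1) hdvd
    rw [leftPoly_eq_sum, hfilter] at h1
    simp at h1
    exact MvPolynomial.mem_support_iff.1 hs h1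
  have hsf := (exponentPoint_mem_leftFace hs).2 hs0
  have htf := (exponentPoint_mem_leftFace ht).2 ht0
  have hne : (exponentPoint s).2 ≠ (exponentPoint t).2 := by simpa [exponentPoint] using hst
  exact ⟨leftFace A, isEdge_leftFace hsf htf hne, ⟨0, fun x hx => hx.2⟩,
    exists_isEdgePolynomial_leftFace (leftPoly_ne_zero hs hs0),
    fun f hf => one_sub_X_pow_dvd_of_isEdgePolynomial hn hsf htf hne hdvd hf⟩

end

end APolynomialRoots

end

theorem mainTheorem3 (n : ℕ) (hn : 0 < n) :
    (∃ A : MvPolynomial (Fin 2) ℤ,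
      APolynomialRoots.IsAPolynomial (APolynomialRoots.gluedPeripheral n) A) ∧
    ∀ A : MvPolynomial (Fin 2) ℤ,
      APolynomialRoots.IsAPolynomial (APolynomialRoots.gluedPeripheral n) A →
      ∃ e : Set (ℝ × ℝ),
        APolynomialRoots.IsEdge (APolynomialRoots.newtonPolygon A) e ∧
        APolynomialRoots.IsVertical e ∧
        (∃ f : Polynomial ℤ, APolynomialRoots.IsEdgePolynomial A e f) ∧
        ∀ f : Polynomial ℤ, APolynomialRoots.IsEdgePolynomial A e f →
          (1 - Polynomial.X ^ n) ∣ f :=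
  ⟨APolynomialRoots.exists_isAPolynomial hn, fun _ hA =>
    APolynomialRoots.exists_vertical_edge hn hA⟩
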